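/- Let $\mathcal{S}$ be a small category and let $R$ be a flat presheaf of commutative rings on $\mathcal{S}$, i.e. for every morphism $v\to w$ of $\mathcal{S}$ the ring $R(v)$ is flat as a module over $R(w)$. Let $\mathcal{A}=\mathrm{Mod}_{\mathrm{cart}}(R)$ be the abelian category of cartesian $R$-modules: presheaves $M$ of $R$-modules such that for every morphism $v\to w$ of $\mathcal{S}$ the canonical map $R(v)\otimes_{R(w)}M(w)\to M(v)$ is an isomorphism. Let $\mathrm{Ch}(\mathcal{A})$ be the category of unbounded complexes in $\mathcal{A}$ and $\mathcal{E}$ its class of acyclic complexes. In an abelian category, a pair $(\mathcal{P},\mathcal{Q})$ of classes of objects is a cotorsion pair if $\mathcal{P}=\{X:\mathrm{Ext}^1(X,Q)=0\ \forall Q\in\mathcal{Q}\}$ and $\mathcal{Q}=\{Y:\mathrm{Ext}^1(P,Y)=0\ \forall P\in\mathcal{P}\}$. It is cogenerated by a set if there is a set $\mathcal{T}$ of objects with $\mathcal{Q}=\{Y:\mathrm{Ext}^1(T,Y)=0\ \forall T\in\mathcal{T}\}$. It is complete if for every object $M$ there are short exact sequences $0\to Q\to P\to M\to 0$ and $0\to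 M\to Q'\to P'\to 0$ with $P,P'\in\mathcal{P}$ and $Q,Q'\in\mathcal{Q}$. Let $(\mathcal{F},\mathcal{C})$ be a cotorsion pair in $\mathcal{A}$ that is cogenerated by a set and such that $\mathcal{F}$ contains a generator of $\mathcal{A}$ and is closed under kernels of epimorphisms between objects of $\mathcal{F}$. Put $$\widetilde{\mathcal{F}}=\{X\in\mathcal{E}: Z_nX\in\mathcal{F}\ \forall n\},\qquad \widetilde{\mathcal{C}}=\{X\in\mathcal{E}: Z_nX\in\mathcal{C}\ \forall n\},$$ $$dg\,\widetilde{\mathcal{F}}=\{X: X_n\in\mathcal{F}\ \forall n,\ \mathrm{Hom}(X,Y)\text{ is exact for all }Y\in\widetilde{\mathcal{C}}\},$$ $$dg\,\widetilde{\mathcal{C}}=\{Y: Y_n\in\mathcal{C}\ \forall n,\ \mathrm{Hom}(X,Y)\text{ is exact for all }X\in\widetilde{\mathcal{F}}\},$$ where $Z_n X$ is the $n$-th cycle object and $\mathrm{Hom}$ is the Hom complex. Then $(dg\,\widetilde{\mathcal{F}},\widetilde{\mathcal{C}})$ and $(\widetilde{\mathcal{F}},dg\,\widetilde{\mathcal{C}})$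 are complete cotorsion pairs in $\mathrm{Ch}(\mathcal{A})$, and they are compatible: $\widetilde{\mathcal{F}}=dg\,\widetilde{\mathcal{F}}\cap\mathcal{E}$ and $\widetilde{\mathcal{C}}=dg\,\widetilde{\mathcal{C}}\cap\mathcal{E}$. They induce an abelian model structure on $\mathrm{Ch}(\mathcal{A})$, that is, a model structure whose (trivial) cofibrations are exactly the monomorphisms with (trivially) cofibrant cokernel and whose (trivial) fibrations are exactly the epimorphisms with (trivially) fibrant kernel. In this model structure * the weak equivalences are the homology isomorphisms; * the cofibrations (resp. trivial cofibrations) are the monomorphisms with cokernel in $dg\,\widetilde{\mathcal{F}}$ (resp. in $\widetilde{\mathcal{F}}$); * the fibrations (resp. trivial fibrations) are the epimorphisms with kernel in $dg\,\widetilde{\mathcal{C}}$ (resp. in $\widetilde{\mathcal{C}}$). The homotopy category of this model structure is the derived category $\mathbf{D}(\mathcal{A})$: the canonical functor $\mathrm{Ch}(\mathcal{A})\to\mathbf{D}(\mathcal{A})$ is a localization at the weak equivalences, and there is an equivalence between the category of cofibrant-fibrant complexes with homotopy classes of maps and $\mathbf{D}(\mathcal{A})$ compatible, up to natural isomorphism,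 with the canonical functors from the category of cofibrant-fibrant complexes. -/

import Mathlib

open CategoryTheory Limits HomotopicalAlgebra

universe w w' v u

/-! ### Cartesian modules -/

namespace CartesianModules

noncomputable section

variable {C : Type w} [SmallCategory C] (R : Cᵒᵖ ⥤ CommRingCat.{w})

/-- The category of modules over a presheaf `R` of commutative rings on a small category. -/
abbrev PMod : Type (w + 1) := PresheafOfModules.{w} (R ⋙ forget₂ CommRingCat RingCat)

/-- Evaluation `M ↦ M(X)`, as a functor to modules over the commutative ring `R(X)`. -/
def evalAt (X : Cᵒᵖ) : PMod R ⥤ ModuleCat.{w} (R.obj X) :=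
  PresheafOfModules.evaluation (R ⋙ forget₂ CommRingCat RingCat) X

/-- The structure maps `M(X) → M(Y)` of `R`-modules, for `f : X ⟶ Y` in `Cᵒᵖ`. -/
def restr {X Y : Cᵒᵖ} (f : X ⟶ Y) :
    evalAt R X ⟶ evalAt R Y ⋙ ModuleCat.restrictScalars (R.map f).hom :=
  PresheafOfModules.restriction (R ⋙ forget₂ CommRingCat RingCat) f

/-- The `R(Y)`-linear map `R(Y) ⊗_{R(X)} M(X) ⟶ M(Y)`, `r ⊗ m ↦ r • M(f)(m)`, natural in `M`,
for `f : X ⟶ Y` in `Cᵒᵖ`; see `baseChange_tmul` for the formula. -/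
def baseChange {X Y : Cᵒᵖ} (f : X ⟶ Y) :
    evalAt R X ⋙ ModuleCat.extendScalars (R.map f).hom ⟶ evalAt R Y where
  app M := (ModuleCat.extendScalars (R.map f).hom).map ((restr R f).app M) ≫
    (ModuleCat.extendRestrictScalarsAdj (R.map f).hom).counit.app ((evalAt R Y).obj M)
  naturality M N g := by
    have h := (restr R f).naturality g
    simp only [Functor.comp_map, Category.assoc] at h ⊢
    rw [← Functor.map_comp_assoc, h, Functor.map_comp_assoc]
    congr 1
    exact (ModuleCat.extendRestrictScalarsAdj (R.map f).hom).counit.naturality _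

open ChangeOfRings TensorProduct in
theorem baseChange_tmul {X Y : Cᵒᵖ} (f : X ⟶ Y) (M : PMod R) (r : R.obj Y)
    (m : (evalAt R X).obj M) :
    ((baseChange R f).app M (r ⊗ₜ[R.obj X, (R.map f).hom] m) : (evalAt R Y).obj M) =
      r • (M.map f m : (evalAt R Y).obj M) :=
  rfl

/-- An `R`-module `M` is cartesian if `R(Y) ⊗_{R(X)} M(X) ⟶ M(Y)` is an isomorphism for every
`f : X ⟶ Y` in `Cᵒᵖ`. -/
def isCartesian : ObjectProperty (PMod R) := fun M =>
  ∀ ⦃X Y : Cᵒᵖ⦄ (f : X ⟶ Y), IsIso ((baseChange R f).app M)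

/-- `R` is flat if `R(Y)` is a flat `R(X)`-module for every `f : X ⟶ Y` in `Cᵒᵖ`. -/
class IsFlat : Prop where
  flat : ∀ ⦃X Y : Cᵒᵖ⦄ (f : X ⟶ Y), (R.map f).hom.Flat

theorem isIso_app_of_isLimit {A B J : Type*} [Category* A] [Category* B] [Category* J]
    {K : J ⥤ A} {L L' : A ⥤ B} (α : L ⟶ L') (h : ∀ j, IsIso (α.app (K.obj j)))
    {c : Cone K} (hc : IsLimit c) [PreservesLimit K L] [PreservesLimit K L'] :
    IsIso (α.app c.pt) := by
  have : IsIso (Functor.whiskerLeft K α) :=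
    ⟨⟨{ app := fun j => inv (α.app (K.obj j)) }, by ext; simp, by ext; simp⟩⟩
  let e := IsLimit.conePointsIsoOfNatIso
    (isLimitOfPreserves L hc) (isLimitOfPreserves L' hc) (asIso (Functor.whiskerLeft K α))
  have he : α.app c.pt = e.hom := by
    refine (isLimitOfPreserves L' hc).hom_ext fun j => ?_
    refine Eq.trans ?_ (IsLimit.map_π (L.mapCone c) (isLimitOfPreserves L' hc)
      (Functor.whiskerLeft K α) j).symm
    simp
  rw [he]
  infer_instance

theorem isIso_app_of_isColimit {A B J : Type*} [Category* A] [Category* B] [Category* J]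
    {K : J ⥤ A} {L L' : A ⥤ B} (α : L ⟶ L') (h : ∀ j, IsIso (α.app (K.obj j)))
    {c : Cocone K} (hc : IsColimit c) [PreservesColimit K L] [PreservesColimit K L'] :
    IsIso (α.app c.pt) := by
  have : IsIso (Functor.whiskerLeft K α) :=
    ⟨⟨{ app := fun j => inv (α.app (K.obj j)) }, by ext; simp, by ext; simp⟩⟩
  exact isIso_app_coconePt_of_preservesColimit K α c hc

instance (X : Cᵒᵖ) : PreservesFiniteLimits (evalAt R X) :=
  PresheafOfModules.evaluation_preservesFiniteLimits (R := R ⋙ forget₂ CommRingCat RingCat) X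
instance (X : Cᵒᵖ) : PreservesFiniteColimits (evalAt R X) :=
  inferInstanceAs (PreservesFiniteColimits
    (PresheafOfModules.evaluation.{w} (R ⋙ forget₂ CommRingCat RingCat) X))

theorem isCartesian_of_isLimit [IsFlat R] {J : Type} [SmallCategory J] [FinCategory J]
    {K : J ⥤ PMod R} (hK : ∀ j, isCartesian R (K.obj j)) {c : Cone K} (hc : IsLimit c) :
    isCartesian R c.pt := fun _ _ f => by
  have : PreservesFiniteLimits (ModuleCat.extendScalars.{w, w, w} (R.map f).hom) :=
    ModuleCat.preservesFiniteLimits_extendScalars_of_flat (IsFlat.flat f)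
  exact isIso_app_of_isLimit (baseChange R f) (fun j => hK j f) hc

theorem isCartesian_of_isColimit {J : Type} [SmallCategory J] [FinCategory J]
    {K : J ⥤ PMod R} (hK : ∀ j, isCartesian R (K.obj j)) {c : Cocone K} (hc : IsColimit c) :
    isCartesian R c.pt := fun _ _ f =>
  isIso_app_of_isColimit (baseChange R f) (fun j => hK j f) hc

instance [IsFlat R] : (isCartesian R).IsClosedUnderKernels where
  kernels_le := by
    rintro _ ⟨g, k, hk, hX, hY⟩
    refine isCartesian_of_isLimit R ?_ hk
    rintro (_ | _)
    exacts [hX, hY]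

instance : (isCartesian R).IsClosedUnderCokernels where
  cokernels_le := by
    rintro _ ⟨g, k, hk, hX, hY⟩
    refine isCartesian_of_isColimit R ?_ hk
    rintro (_ | _)
    exacts [hX, hY]

instance [IsFlat R] : (isCartesian R).IsClosedUnderFiniteProducts :=
  .mk fun J _ => .mk <| by
    rintro M ⟨p⟩
    have := Fintype.ofFinite J
    classical
    exact isCartesian_of_isLimit (J := Discrete J) R (K := p.diag)
      (c := Cone.mk M p.π) p.prop_diag_obj p.isLimit

instance [IsFlat R] : (isCartesian R).ContainsZero where
  exists_zero := ⟨⊤_ _, (isZero_zero _).of_iso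
    (HasZeroObject.zeroIsoIsTerminal terminalIsTerminal).symm, ObjectProperty.prop_terminal _⟩

/-- The category of cartesian `R`-modules, a full subcategory of the category of `R`-modules. -/
abbrev ModCart : Type (w + 1) := (isCartesian R).FullSubcategory

instance [IsFlat R] : Abelian (ModCart R) := inferInstance

end

end CartesianModules

/-! ### Cotorsion pairs in abelian categories -/

namespace CotorsionPairs

variable {A : Type u} [Category.{v} A] [Abelian A]

/-- `Ext¹(X, Y) = 0`. -/
def ExtOneVanishes (X Y : A) : Prop :=
  letI := HasExt.standard A
  Subsingleton (Abelian.Ext X Y 1)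

/-- `𝓣^⊥`, the class of all `Y` with `Ext¹(X, Y) = 0` for all `X` in `𝓣`. -/
def rightPerp (T : ObjectProperty A) : ObjectProperty A :=
  fun Y => ∀ X, T X → ExtOneVanishes X Y

/-- `^⊥𝓣`, the class of all `X` with `Ext¹(X, Y) = 0` for all `Y` in `𝓣`. -/
def leftPerp (T : ObjectProperty A) : ObjectProperty A :=
  fun X => ∀ Y, T Y → ExtOneVanishes X Y

/-- `(𝓕, 𝓒)` is a cotorsion pair if `𝓕 = ^⊥𝓒` and `𝓒 = 𝓕^⊥`. -/
structure IsCotorsionPair (F D : ObjectProperty A) : Prop where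
  left : F = leftPerp D
  right : D = rightPerp F

/-- A cotorsion pair with second class `𝓒` is cogenerated by a set if there is a set `𝓣` of objects
with `𝓣^⊥ = 𝓒`. -/
def IsCogeneratedBySet (D : ObjectProperty A) : Prop :=
  ∃ T : ObjectProperty A, ObjectProperty.Small.{v} T ∧ rightPerp T = D

/-- A complete cotorsion pair: every object `M` fits in short exact sequences
`0 → C → F → M → 0` and `0 → M → C' → F' → 0` with `F, F'` in `𝓕` and `C, C'` in `𝓒`. -/
structure IsCompleteCotorsionPair (F D : ObjectProperty A) : Prop extends
    IsCotorsionPair F D where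
  enough_projectives : ∀ M : A, ∃ S : ShortComplex A,
    S.ShortExact ∧ S.X₃ = M ∧ F S.X₂ ∧ D S.X₁
  enough_injectives : ∀ M : A, ∃ S : ShortComplex A,
    S.ShortExact ∧ S.X₁ = M ∧ D S.X₂ ∧ F S.X₃

/-! ### Induced classes of unbounded complexes -/

/-- The class `𝓔` of acyclic complexes. -/
def acyclic (A : Type u) [Category.{v} A] [Abelian A] : ObjectProperty (CochainComplex A ℤ) :=
  fun X => X.Acyclic

/-- The class `𝓛~` of acyclic complexes all of whose cycle objects are in `𝓛`. -/
def tilde (L : ObjectProperty A) : ObjectProperty (CochainComplex A ℤ) :=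
  fun X => X.Acyclic ∧ ∀ n : ℤ, L (X.cycles n)

/-- For a cotorsion pair `(𝓕, 𝓒)`, the class `dg 𝓕~` of complexes with components in `𝓕` such
that the Hom complex into every complex in `𝓒~` is exact. -/
def dgLeft (F D : ObjectProperty A) : ObjectProperty (CochainComplex A ℤ) :=
  fun X => (∀ n : ℤ, F (X.X n)) ∧
    ∀ Y : CochainComplex A ℤ, tilde D Y → (CochainComplex.HomComplex X Y).Acyclic

/-- For a cotorsion pair `(𝓕, 𝓒)`, the class `dg 𝓒~` of complexes with components in `𝓒` such
that the Hom complex from every complex in `𝓕~` is exact. -/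
def dgRight (F D : ObjectProperty A) : ObjectProperty (CochainComplex A ℤ) :=
  fun Y => (∀ n : ℤ, D (Y.X n)) ∧
    ∀ X : CochainComplex A ℤ, tilde F X → (CochainComplex.HomComplex X Y).Acyclic

/-- Pairs `(𝓟, 𝓟')` and `(𝓠', 𝓠)` of classes of complexes are compatible if
`𝓠' = 𝓟 ∩ 𝓔` and `𝓟' = 𝓠 ∩ 𝓔`. -/
def AreCompatible (P P' Q' Q : ObjectProperty (CochainComplex A ℤ)) : Prop :=
  Q' = P ⊓ acyclic A ∧ P' = Q ⊓ acyclic A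

/-! ### Abelian model structures -/

/-- Monomorphisms whose cokernel is in `P`. -/
def monoWithCokernelIn (P : ObjectProperty A) : MorphismProperty A :=
  fun _ _ f => Mono f ∧ P (cokernel f)

/-- Epimorphisms whose kernel is in `P`. -/
def epiWithKernelIn (P : ObjectProperty A) : MorphismProperty A :=
  fun _ _ f => Epi f ∧ P (kernel f)

/-- A model structure on an abelian category is abelian if the (trivial) cofibrations are the
monomorphisms with (trivially) cofibrant cokernel and the (trivial) fibrations are the epimorphisms
with (trivially) fibrant kernel. -/
structure IsAbelianModelStructure (A : Type u) [Category.{v} A] [Abelian A] [ModelCategory A] :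
    Prop where
  cofibrations_eq : cofibrations A = monoWithCokernelIn (fun X => IsCofibrant X)
  trivialCofibrations_eq : trivialCofibrations A =
    monoWithCokernelIn (fun X => IsCofibrant X ∧ WeakEquivalence (initial.to X))
  fibrations_eq : fibrations A = epiWithKernelIn (fun X => IsFibrant X)
  trivialFibrations_eq : trivialFibrations A =
    epiWithKernelIn (fun X => IsFibrant X ∧ WeakEquivalence (terminal.from X))

end CotorsionPairs

open CartesianModules CotorsionPairs

/-!
# The model structure on complexes of cartesian modules induced by a cotorsion pair

The category of cartesian modules over a flat presheaf of rings is a Grothendieck abelian category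
(`isGrothendieckAbelian`): flatness makes finite limits of cartesian modules agree with those of all
presheaves of modules, all colimits agree in any case, and the separator is the given generator
in `𝓕`. From then on only a Grothendieck abelian category `A` matters, with a cotorsion pair
`(𝓕, 𝓓)` which is cogenerated by a set, where `𝓕` contains a separator and is closed under kernels
of epimorphisms.

*Approximations.* A cotorsion pair which is cogenerated by a set is complete as soon as its left
class covers every object (`isCompleteCotorsionPair_of_small`). This is the small object argument,
applied to the kernels of the canonical epimorphisms onto the test objects from coproducts of copies
of a separator, together with Salce's exchange argument.

*The induced pairs.* Exactness of the Hom complex amounts to vanishing of `Ext¹` on all shifts when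
the components have no extensions (`ExtOneVanishes.of_homComplex_acyclic`,
`ExtOneVanishes.homotopy`). Testing against discs and against objects in a single degree, one finds
that `(dg 𝓕~, 𝓓~)` and `(𝓕~, dg 𝓓~)` are cotorsion pairs, the first of which is cogenerated by
a set of spheres and discs and is therefore complete. The closure of `𝓕` under kernels of
epimorphisms yields closure of `𝓓` under cokernels of monomorphisms
(`IsCotorsionPair.right_cokernel`), so that the augmented injective resolution of an object of `𝓓`
is in `𝓓~`; this gives `𝓕~ = dg 𝓕~ ∩ 𝓔` (`IsCotorsionPair.tilde_left_eq_inf`), and then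
`𝓓~ = dg 𝓓~ ∩ 𝓔` follows from completeness of the first pair
(`IsCotorsionPair.tilde_right_eq_inf`).

*Completeness of the second pair.* No set cogenerating `(𝓕~, dg 𝓓~)` is needed. Instead, the
acyclic complexes are shown to form the left class of a complete cotorsion pair
(`isCompleteCotorsionPair_acyclic`): its right class, the dg-injective complexes, is detected by the
acyclic complexes with components in a suitable set of objects. An arbitrary complex `M` then embeds
in a dg-injective complex with acyclic cokernel `N`, and an approximation of `N` by the first
induced pair, which lies in `𝓕~` by compatibility, is pulled back to correct this embedding
(`IsCotorsionPair.isCompleteCotorsionPair_tilde_dgRight`).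

*The model structure.* A complete cotorsion pair defines a weak factorization system, of the
monomorphisms with cokernel in the left class and the epimorphisms with kernel in the right class
(`IsCompleteCotorsionPair.isWeakFactorizationSystem`). Compatibility says that the two weak
factorization systems obtained from the induced pairs fit together to a model structure with the
quasi-isomorphisms as weak equivalences (`AreCompatible.exists_modelCategory`). Both its homotopy
category of bifibrant objects and the derived category are localizations of the bifibrant complexes
at the quasi-isomorphisms, hence they are equivalent.
-/

namespace CotorsionPairs

/-! ### Vanishing of `Ext¹` and extensions of morphisms -/

section ExtOne

variable {A : Type u} [Category.{v} A] [Abelian A]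

lemma shortExact_kernel {X Y : A} (p : X ⟶ Y) [Epi p] :
    (ShortComplex.mk _ _ (kernel.condition p)).ShortExact where
  exact := ShortComplex.exact_kernel p

lemma shortExact_cokernel {X Y : A} (i : X ⟶ Y) [Mono i] :
    (ShortComplex.mk _ _ (cokernel.condition i)).ShortExact where
  exact := ShortComplex.exact_cokernel i

lemma extOneVanishes_iff (X Y : A) :
    let := HasExt.standard A
    ExtOneVanishes X Y ↔ ∀ e : Abelian.Ext X Y 1, e = 0 :=
  ⟨fun h _ => h.elim _ _, fun h => ⟨fun _ _ => (h _).trans (h _).symm⟩⟩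

lemma ExtOneVanishes.exists_lift {S : ShortComplex A} (hS : S.ShortExact) {T : A}
    (h : ExtOneVanishes T S.X₁) (f : T ⟶ S.X₃) : ∃ g : T ⟶ S.X₂, g ≫ S.g = f := by
  let := HasExt.standard A
  obtain ⟨x, hx⟩ := Abelian.Ext.covariant_sequence_exact₃ T hS (Abelian.Ext.mk₀ f) (zero_add 1)
    (((extOneVanishes_iff _ _).1 h) _)
  obtain ⟨g, rfl⟩ := Abelian.Ext.homEquiv₀.symm.surjective x
  refine ⟨g, Abelian.Ext.homEquiv₀.symm.injective ?_⟩
  simpa using hx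

lemma ExtOneVanishes.exists_extension {S : ShortComplex A} (hS : S.ShortExact) {Y : A}
    (h : ExtOneVanishes S.X₃ Y) (f : S.X₁ ⟶ Y) : ∃ g : S.X₂ ⟶ Y, S.f ≫ g = f := by
  let := HasExt.standard A
  obtain ⟨x, hx⟩ := Abelian.Ext.contravariant_sequence_exact₁ hS Y (Abelian.Ext.mk₀ f)
    (add_zero 1) (((extOneVanishes_iff _ _).1 h) _)
  obtain ⟨g, rfl⟩ := Abelian.Ext.homEquiv₀.symm.surjective x
  refine ⟨g, Abelian.Ext.homEquiv₀.symm.injective ?_⟩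
  simpa using hx

/-- If the middle term of a short exact sequence is orthogonal to `T`, then vanishing of
`Ext¹(T, S.X₁)` amounts to liftability of the morphisms from `T` to the third term. -/
lemma ExtOneVanishes.of_lift {S : ShortComplex A} (hS : S.ShortExact) {T : A}
    (h : ExtOneVanishes T S.X₂) (H : ∀ f : T ⟶ S.X₃, ∃ g : T ⟶ S.X₂, g ≫ S.g = f) :
    ExtOneVanishes T S.X₁ := by
  let := HasExt.standard A
  refine (extOneVanishes_iff _ _).2 fun e => ?_
  obtain ⟨x, rfl⟩ := Abelian.Ext.covariant_sequence_exact₁ T hS e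
    (((extOneVanishes_iff _ _).1 h) _) (zero_add 1)
  obtain ⟨f, rfl⟩ := Abelian.Ext.homEquiv₀.symm.surjective x
  obtain ⟨g, rfl⟩ := H f
  simp [← Abelian.Ext.mk₀_comp_mk₀]

lemma ExtOneVanishes.of_extension {S : ShortComplex A} (hS : S.ShortExact) {Y : A}
    (h : ExtOneVanishes S.X₂ Y) (H : ∀ f : S.X₁ ⟶ Y, ∃ g : S.X₂ ⟶ Y, S.f ≫ g = f) :
    ExtOneVanishes S.X₃ Y := by
  let := HasExt.standard A
  refine (extOneVanishes_iff _ _).2 fun e => ?_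
  obtain ⟨x, rfl⟩ := Abelian.Ext.contravariant_sequence_exact₃ hS Y e
    (((extOneVanishes_iff _ _).1 h) _) (add_zero 1)
  obtain ⟨f, rfl⟩ := Abelian.Ext.homEquiv₀.symm.surjective x
  obtain ⟨g, rfl⟩ := H f
  simp [← Abelian.Ext.mk₀_comp_mk₀]

lemma ExtOneVanishes.of_injective (X I : A) [Injective I] : ExtOneVanishes X I := by
  let := HasExt.standard A
  exact (extOneVanishes_iff _ _).2 fun e => Abelian.Ext.eq_zero_of_injective e

lemma ExtOneVanishes.ext_right {S : ShortComplex A} (hS : S.ShortExact) {T : A}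
    (h₁ : ExtOneVanishes T S.X₁) (h₃ : ExtOneVanishes T S.X₃) : ExtOneVanishes T S.X₂ := by
  let := HasExt.standard A
  refine (extOneVanishes_iff _ _).2 fun e => ?_
  obtain ⟨x, rfl⟩ := Abelian.Ext.covariant_sequence_exact₂ T hS e
    (((extOneVanishes_iff _ _).1 h₃) _)
  rw [(extOneVanishes_iff _ _).1 h₁ x, Abelian.Ext.zero_comp]

lemma ExtOneVanishes.ext_left {S : ShortComplex A} (hS : S.ShortExact) {Y : A}
    (h₁ : ExtOneVanishes S.X₁ Y) (h₃ : ExtOneVanishes S.X₃ Y) : ExtOneVanishes S.X₂ Y := by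
  let := HasExt.standard A
  refine (extOneVanishes_iff _ _).2 fun e => ?_
  obtain ⟨x, rfl⟩ := Abelian.Ext.contravariant_sequence_exact₂ hS Y e
    (((extOneVanishes_iff _ _).1 h₁) _)
  rw [(extOneVanishes_iff _ _).1 h₃ x, Abelian.Ext.comp_zero]

lemma ExtOneVanishes.retract_left {X X' Y : A} (r : Retract X' X) (h : ExtOneVanishes X Y) :
    ExtOneVanishes X' Y := by
  let := HasExt.standard A
  refine (extOneVanishes_iff _ _).2 fun e => ?_
  have h1 := (extOneVanishes_iff _ _).1 h ((Abelian.Ext.mk₀ r.r).comp e (zero_add 1))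
  have h2 := congrArg (fun x => (Abelian.Ext.mk₀ r.i).comp x (zero_add 1)) h1
  simpa using h2

lemma ExtOneVanishes.retract_right {X Y Y' : A} (r : Retract Y' Y) (h : ExtOneVanishes X Y) :
    ExtOneVanishes X Y' := by
  let := HasExt.standard A
  refine (extOneVanishes_iff _ _).2 fun e => ?_
  have h1 := (extOneVanishes_iff _ _).1 h (e.comp (Abelian.Ext.mk₀ r.i) (add_zero 1))
  have h2 := congrArg (fun x => x.comp (Abelian.Ext.mk₀ r.r) (add_zero 1)) h1
  simpa using h2

lemma ExtOneVanishes.exists_section {S : ShortComplex A} (hS : S.ShortExact)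
    (h : ExtOneVanishes S.X₃ S.X₁) : ∃ s : S.X₃ ⟶ S.X₂, s ≫ S.g = 𝟙 _ :=
  h.exists_lift hS _

lemma ExtOneVanishes.exists_retraction {S : ShortComplex A} (hS : S.ShortExact)
    (h : ExtOneVanishes S.X₃ S.X₁) : ∃ r : S.X₂ ⟶ S.X₁, S.f ≫ r = 𝟙 _ :=
  h.exists_extension hS _

/-- The pullback of a short exact sequence along a morphism to its third term. -/
lemma shortExact_of_isPullback {S : ShortComplex A} (hS : S.ShortExact) {P T : A}
    {fst : P ⟶ S.X₂} {snd : P ⟶ T} {f : T ⟶ S.X₃} (h : IsPullback fst snd S.g f) :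
    ∃ (i : S.X₁ ⟶ P) (w : i ≫ snd = 0), i ≫ fst = S.f ∧ (ShortComplex.mk i snd w).ShortExact := by
  have := hS.epi_g
  have := hS.mono_f
  have hw : S.f ≫ S.g = 0 ≫ f := by simp
  have hi : h.lift S.f 0 hw ≫ fst = S.f := h.lift_fst _ _ _
  have hi' : h.lift S.f 0 hw ≫ snd = 0 := h.lift_snd _ _ _
  have hm : Mono (h.lift S.f 0 hw) := mono_of_mono_fac hi
  refine ⟨h.lift S.f 0 hw, hi', hi,
    { exact := ShortComplex.exact_of_f_is_kernel _
        (KernelFork.IsLimit.ofι' _ _ fun {T'} k hk => ?_)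
      mono_f := hm
      epi_g := Abelian.epi_snd_of_isLimit _ _ h.isLimit }⟩
  have h1 : (k ≫ fst) ≫ S.g = 0 := by
    rw [Category.assoc, h.w, reassoc_of% hk, zero_comp]
  obtain ⟨l, hl⟩ := KernelFork.IsLimit.lift' hS.fIsKernel _ h1
  refine ⟨l, h.hom_ext ?_ ?_⟩
  · rw [Category.assoc, hi]
    exact hl
  · rw [Category.assoc, hi', hk, comp_zero]

/-- The pushout of a short exact sequence along a morphism from its first term. -/
lemma shortExact_of_isPushout {S : ShortComplex A} (hS : S.ShortExact) {P T : A}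
    {f : S.X₁ ⟶ T} {inl : S.X₂ ⟶ P} {inr : T ⟶ P} (h : IsPushout S.f f inl inr) :
    ∃ (p : P ⟶ S.X₃) (w : inr ≫ p = 0), inl ≫ p = S.g ∧ (ShortComplex.mk inr p w).ShortExact := by
  have := hS.epi_g
  have := hS.mono_f
  have hw : S.f ≫ S.g = f ≫ 0 := by simp
  have hi : inl ≫ h.desc S.g 0 hw = S.g := h.inl_desc _ _ _
  have hi' : inr ≫ h.desc S.g 0 hw = 0 := h.inr_desc _ _ _
  have hm : Epi (h.desc S.g 0 hw) := epi_of_epi_fac hi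
  refine ⟨h.desc S.g 0 hw, hi', hi,
    { exact := ShortComplex.exact_of_g_is_cokernel _
        (CokernelCofork.IsColimit.ofπ' _ _ fun {T'} k hk => ?_)
      mono_f := Abelian.mono_inr_of_isColimit _ _ h.isColimit
      epi_g := hm }⟩
  have h1 : S.f ≫ inl ≫ k = 0 := by
    rw [← Category.assoc, h.w, Category.assoc, hk, comp_zero]
  obtain ⟨l, hl⟩ := CokernelCofork.IsColimit.desc' hS.gIsCokernel _ h1
  refine ⟨l, h.hom_ext ?_ ?_⟩
  · rw [← Category.assoc, hi]
    exact hl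
  · rw [← Category.assoc, hi', hk, zero_comp]

/-- A monomorphism `i` has the left lifting property with respect to an epimorphism `p` as soon as
`Ext¹(coker i, ker p) = 0`: the vanishing is used once to lift the bottom map, the obstruction
dying on the source of `i`, and once to correct the lift. -/
lemma ExtOneVanishes.hasLiftingProperty {B C X Y : A} (i : B ⟶ C) (p : X ⟶ Y) [Mono i] [Epi p]
    (h : ExtOneVanishes (cokernel i) (kernel p)) : HasLiftingProperty i p where
  sq_hasLift {t b} sq := by
    let := HasExt.standard A
    have hi := shortExact_cokernel i
    have hp := shortExact_kernel p
    -- the obstruction to lifting `b`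
    have hb : (Abelian.Ext.mk₀ b).comp hp.extClass (zero_add 1) = 0 := by
      have h0 : (Abelian.Ext.mk₀ i).comp ((Abelian.Ext.mk₀ b).comp hp.extClass (zero_add 1))
          (zero_add 1) = 0 := by
        rw [Abelian.Ext.mk₀_comp_mk₀_assoc, ← sq.w, ← Abelian.Ext.mk₀_comp_mk₀_assoc,
          hp.comp_extClass, Abelian.Ext.comp_zero]
      obtain ⟨x, hx⟩ := Abelian.Ext.contravariant_sequence_exact₂ hi _ _ h0
      rw [← hx, (extOneVanishes_iff _ _).1 h x, Abelian.Ext.comp_zero]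
    obtain ⟨x, hx⟩ := Abelian.Ext.covariant_sequence_exact₃ C hp (Abelian.Ext.mk₀ b)
      (zero_add 1) hb
    obtain ⟨l, rfl⟩ := Abelian.Ext.homEquiv₀.symm.surjective x
    have hl : l ≫ p = b := Abelian.Ext.homEquiv₀.symm.injective (by simpa using hx)
    obtain ⟨c, hc⟩ := h.exists_extension hi (kernel.lift p (t - i ≫ l) (by simp [hl, sq.w]))
    refine ⟨⟨⟨l + c ≫ kernel.ι p, ?_, by simp [hl]⟩⟩⟩
    have hc' : i ≫ c ≫ kernel.ι p = t - i ≫ l := by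
      rw [← Category.assoc]
      erw [hc]
      simp
    rw [Preadditive.comp_add, hc']
    abel

variable [EnoughInjectives A]

/-- In the presence of enough injectives, `Ext¹(X, Y)` vanishes as soon as all extensions
of `X` by `Y` split. -/
lemma ExtOneVanishes.of_split {X Y : A}
    (H : ∀ (E : A) (i : Y ⟶ E) (p : E ⟶ X) (w : i ≫ p = 0), (ShortComplex.mk i p w).ShortExact →
      ∃ s : X ⟶ E, s ≫ p = 𝟙 _) : ExtOneVanishes X Y := by
  have hS := shortExact_cokernel (Injective.ι Y)
  refine ExtOneVanishes.of_lift hS (.of_injective _ _) fun f => ?_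
  have hp := IsPullback.of_hasPullback (cokernel.π (Injective.ι Y)) f
  obtain ⟨i, w, -, hS'⟩ := shortExact_of_isPullback hS hp
  obtain ⟨s, hs⟩ := H _ i _ w hS'
  refine ⟨s ≫ pullback.fst _ _, ?_⟩
  dsimp
  rw [Category.assoc, hp.w, reassoc_of% hs]

/-- A splitting over each summand gives a splitting over the coproduct; in this way the vanishing
of `Ext¹` on coproducts does not need their exactness. -/
lemma ExtOneVanishes.coproduct {ι : Type*} (X : ι → A) [HasCoproduct X] {Y : A}
    (h : ∀ i, ExtOneVanishes (X i) Y) : ExtOneVanishes (∐ X) Y := by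
  refine .of_split fun E i p w hS => ?_
  choose s hs using fun j => (h j).exists_lift hS (Sigma.ι X j)
  exact ⟨Sigma.desc s, Sigma.hom_ext _ _ fun j => by simpa using hs j⟩

end ExtOne

/-! ### Orthogonal classes -/

section Perp

variable {A : Type u} [Category.{v} A] [Abelian A]

lemma le_leftPerp_rightPerp (T : ObjectProperty A) : T ≤ leftPerp (rightPerp T) :=
  fun X hX _ hY => hY X hX

lemma le_rightPerp_leftPerp (T : ObjectProperty A) : T ≤ rightPerp (leftPerp T) :=
  fun Y hY _ hX => hX Y hY

lemma rightPerp_antitone {T T' : ObjectProperty A} (h : T ≤ T') : rightPerp T' ≤ rightPerp T :=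
  fun _ hY X hX => hY X (h X hX)

lemma leftPerp_antitone {T T' : ObjectProperty A} (h : T ≤ T') : leftPerp T' ≤ leftPerp T :=
  fun _ hX Y hY => hX Y (h Y hY)

/-- A class which is a right orthogonal forms a cotorsion pair with its left orthogonal. -/
lemma isCotorsionPair_leftPerp_rightPerp (T : ObjectProperty A) :
    IsCotorsionPair (leftPerp (rightPerp T)) (rightPerp T) where
  left := rfl
  right := le_antisymm (le_rightPerp_leftPerp _) (rightPerp_antitone (le_leftPerp_rightPerp T))

instance (T : ObjectProperty A) : (rightPerp T).IsStableUnderRetracts where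
  of_retract r h X hX := (h X hX).retract_right r

instance (T : ObjectProperty A) : (leftPerp T).IsStableUnderRetracts where
  of_retract r h Y hY := (h Y hY).retract_left r

lemma rightPerp_ext (T : ObjectProperty A) {S : ShortComplex A} (hS : S.ShortExact)
    (h₁ : rightPerp T S.X₁) (h₃ : rightPerp T S.X₃) : rightPerp T S.X₂ :=
  fun X hX => .ext_right hS (h₁ X hX) (h₃ X hX)

lemma leftPerp_ext (T : ObjectProperty A) {S : ShortComplex A} (hS : S.ShortExact)
    (h₁ : leftPerp T S.X₁) (h₃ : leftPerp T S.X₃) : leftPerp T S.X₂ :=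
  fun Y hY => .ext_left hS (h₁ Y hY) (h₃ Y hY)

lemma rightPerp_of_injective (T : ObjectProperty A) (I : A) [Injective I] : rightPerp T I :=
  fun X _ => .of_injective X I

namespace IsCotorsionPair

variable {F D : ObjectProperty A} (h : IsCotorsionPair F D)

include h

lemma extOneVanishes {X Y : A} (hX : F X) (hY : D Y) : ExtOneVanishes X Y := by
  rw [h.left] at hX
  exact hX Y hY

lemma left_iff (X : A) : F X ↔ ∀ Y, D Y → ExtOneVanishes X Y := by
  conv_lhs => rw [h.left]
  rfl

lemma right_iff (Y : A) : D Y ↔ ∀ X, F X → ExtOneVanishes X Y := by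
  conv_lhs => rw [h.right]
  rfl

lemma left_isStableUnderRetracts : F.IsStableUnderRetracts := by
  rw [h.left]
  infer_instance

lemma right_isStableUnderRetracts : D.IsStableUnderRetracts := by
  rw [h.right]
  infer_instance

lemma left_ext {S : ShortComplex A} (hS : S.ShortExact) (h₁ : F S.X₁) (h₃ : F S.X₃) :
    F S.X₂ := by
  rw [h.left] at h₁ h₃ ⊢
  exact leftPerp_ext _ hS h₁ h₃

lemma right_ext {S : ShortComplex A} (hS : S.ShortExact) (h₁ : D S.X₁) (h₃ : D S.X₃) :
    D S.X₂ := by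
  rw [h.right] at h₁ h₃ ⊢
  exact rightPerp_ext _ hS h₁ h₃

lemma right_of_injective (I : A) [Injective I] : D I := by
  rw [h.right]
  exact rightPerp_of_injective _ I

lemma left_coproduct [EnoughInjectives A] {ι : Type*} (X : ι → A) [HasCoproduct X]
    (hX : ∀ i, F (X i)) : F (∐ X) :=
  (h.left_iff _).2 fun _ hY => .coproduct _ fun i => h.extOneVanishes (hX i) hY

end IsCotorsionPair

end Perp

/-! ### Approximations by a cotorsion pair which is cogenerated by a set -/

section SmallObject

open ZeroObject

variable {A : Type u} [Category.{v} A] [Abelian A] [IsGrothendieckAbelian.{v} A]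

open MorphismProperty IsGrothendieckAbelian in
/-- Every small family of monomorphisms of a Grothendieck abelian category permits the small
object argument: the relevant colimits are colimits of monomorphisms. -/
lemma hasSmallObjectArgument_of_le_monomorphisms (J : MorphismProperty A) [IsSmall.{v} J]
    (hJ : J ≤ monomorphisms A) : HasSmallObjectArgument.{v} J := by
  obtain ⟨ι, U, V, f, rfl⟩ := (isSmall_iff_eq_ofHoms J).1 inferInstance
  obtain ⟨κ, hκ', hκ⟩ := HasCardinalLT.exists_regular_cardinal.{v} (Σ i, Subobject (U i))
  have : Fact κ.IsRegular := ⟨hκ'⟩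
  have : Nonempty κ.ord.ToType := by simpa using hκ'.ne_zero
  have := WellFoundedLT.toOrderBot κ.ord.ToType
  exact ⟨κ, inferInstance, inferInstance,
    { preservesColimit {A' B X' Y'} i hi f' hf := by
        let hf' : (monomorphisms A).TransfiniteCompositionOfShape κ.ord.ToType f' :=
          { toTransfiniteCompositionOfShape := hf.toTransfiniteCompositionOfShape
            map_mem j hj := by
              have := (hf.attachCells j hj).pushouts_coproducts
              simp only [ofHoms_homFamily] at this
              refine (?_ : _ ≤ monomorphisms A) _ this
              simp only [pushouts_le_iff, coproducts_le_iff]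
              exact hJ }
        have (j j' : κ.ord.ToType) (φ : j ⟶ j') : Mono (hf'.F.map φ) := hf'.mem_map φ
        apply preservesColimit_coyoneda_obj_of_mono (Y := hf'.F) (κ := κ)
        obtain ⟨k⟩ := hi
        exact hκ.of_injective (fun S => Sigma.mk (β := fun i => Subobject (U i)) k S)
          fun _ _ h => eq_of_heq (Sigma.mk.inj h).2 }⟩

variable (G : A)

/-- The canonical morphism to `X` from the coproduct of copies of `G` indexed by a set of
morphisms `G ⟶ X`. -/
noncomputable def coprodDesc {X : A} (I : Set (G ⟶ X)) : (∐ fun _ : I => G) ⟶ X :=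
  Sigma.desc fun i => i.1

@[simp]
lemma ι_coprodDesc {X : A} (I : Set (G ⟶ X)) (i : I) :
    Sigma.ι (fun _ : I => G) i ≫ coprodDesc G I = i.1 := by
  simp [coprodDesc]

@[simp]
lemma ι_coprodDesc_assoc {X Y : A} (I : Set (G ⟶ X)) (i : I) (f : X ⟶ Y) :
    Sigma.ι (fun _ : I => G) i ≫ coprodDesc G I ≫ f = i.1 ≫ f := by
  rw [← Category.assoc, ι_coprodDesc]

variable {G} in
/-- If `p : E ⟶ X` is an epimorphism, those morphisms from a separator to `X` which lift to `E`
are jointly epimorphic, and their coproduct lifts to `E`. -/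
lemma exists_epi_coprodDesc (hG : IsSeparator G) {E X : A} (p : E ⟶ X) [Epi p] :
    ∃ (I : Set (G ⟶ X)) (l : (∐ fun _ : I => G) ⟶ E),
      Epi (coprodDesc G I) ∧ l ≫ p = coprodDesc G I := by
  let I : Set (G ⟶ X) := {f | ∃ g : G ⟶ E, g ≫ p = f}
  choose l hl using fun i : I => i.2
  refine ⟨I, Sigma.desc l, ⟨fun f g hfg => ?_⟩, Sigma.hom_ext _ _ fun i => by simp [hl]⟩
  rw [← cancel_epi p]
  refine hG.def _ _ fun h => ?_
  have := Sigma.ι (fun _ : I => G) ⟨h ≫ p, h, rfl⟩ ≫= hfg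
  simpa using this

/-- The set of morphisms that detects the right orthogonal of `T`: the kernels of the canonical
epimorphisms from a coproduct of copies of `G`, indexed by a set of morphisms `G ⟶ X`, to an
object `X` in `T`. -/
def generatingMonos (T : ObjectProperty A) : MorphismProperty A :=
  .ofHoms (ι := {x : Σ X : Subtype T, Set (G ⟶ X.1) // Epi (coprodDesc G x.2)})
    fun x => kernel.ι (coprodDesc G x.1.2)

instance (T : ObjectProperty A) [ObjectProperty.Small.{v} T] :
    MorphismProperty.IsSmall.{v} (generatingMonos G T) := by
  have : Small.{v} (Subtype T) := inferInstanceAs (ObjectProperty.Small.{v} T)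
  dsimp [generatingMonos]
  infer_instance

lemma generatingMonos_le (T : ObjectProperty A) :
    generatingMonos G T ≤ MorphismProperty.monomorphisms A := by
  rintro _ _ _ ⟨x⟩
  exact inferInstanceAs (Mono (kernel.ι _))

variable {G}

/-- An epimorphism whose kernel is in `T^⊥` has the right lifting property with respect
to `generatingMonos G T`. -/
lemma generatingMonos_rlp_of_epi {T : ObjectProperty A} {X Y : A} (p : X ⟶ Y) [Epi p]
    (hp : rightPerp T (kernel p)) : (generatingMonos G T).rlp p := by
  rintro _ _ _ ⟨⟨⟨Z, I⟩, hI⟩⟩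
  have : Epi (coprodDesc G I) := hI
  have e : cokernel (kernel.ι (coprodDesc G I)) ≅ Z.1 :=
    (cokernelIsCokernel _).coconePointUniqueUpToIso
      (shortExact_kernel (coprodDesc G I)).gIsCokernel
  exact ExtOneVanishes.hasLiftingProperty _ _ ((hp _ Z.2).retract_left e.retract)

/-- If every morphism to `Y` extends along the morphisms in `generatingMonos G T`, then `Y`
is in `T^⊥`. -/
lemma rightPerp_of_generatingMonos (hG : IsSeparator G) {T : ObjectProperty A} {Y : A}
    (hY : ∀ ⦃K P : A⦄ (i : K ⟶ P), generatingMonos G T i → ∀ f : K ⟶ Y, ∃ g, i ≫ g = f) :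
    rightPerp T Y := by
  refine fun X hX => .of_split fun E i p w hS => ?_
  have : Epi p := hS.epi_g
  obtain ⟨I, l, hI, hl⟩ := exists_epi_coprodDesc hG p
  obtain ⟨k, hk⟩ := KernelFork.IsLimit.lift' hS.fIsKernel (kernel.ι (coprodDesc G I) ≫ l)
    (by simp [hl])
  dsimp at hk
  obtain ⟨e, he⟩ := hY _ ⟨⟨⟨⟨X, hX⟩, I⟩, hI⟩⟩ k
  obtain ⟨s, hs⟩ := CokernelCofork.IsColimit.desc'
    (shortExact_kernel (coprodDesc G I)).gIsCokernel (l - e ≫ i)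
    (by dsimp at he ⊢; rw [Preadditive.comp_sub, ← hk, ← reassoc_of% he, sub_self])
  dsimp at hs
  refine ⟨s, ?_⟩
  rw [← cancel_epi (coprodDesc G I), reassoc_of% hs]
  simp [hl, w]

/-- Every object of a Grothendieck abelian category embeds in an object of `T^⊥`, with a cokernel
in `^⊥(T^⊥)`, if `T` is a set of objects. The embedding is obtained by the small object argument;
that its cokernel is in `^⊥(T^⊥)` follows from the lifting property of the embedding with
respect to extensions of the cokernel by objects of `T^⊥`. -/
theorem exists_rightPerp_embedding (T : ObjectProperty A) [ObjectProperty.Small.{v} T] (M : A) :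
    ∃ (Q P : A) (i : M ⟶ Q) (q : Q ⟶ P) (w : i ≫ q = 0), (ShortComplex.mk i q w).ShortExact ∧
      rightPerp T Q ∧ leftPerp (rightPerp T) P := by
  have hG := isSeparator_separator A
  let J := generatingMonos (separator A) T
  have := hasSmallObjectArgument_of_le_monomorphisms J (generatingMonos_le _ T)
  let fac := MorphismProperty.factorizationData J.rlp.llp J.rlp (0 : M ⟶ 0)
  have hi : Mono fac.i := by
    have h := MorphismProperty.antitone_llp
      (MorphismProperty.antitone_rlp (generatingMonos_le (separator A) T)) _ fac.hi
    rwa [IsGrothendieckAbelian.llp_rlp_monomorphisms hG] at h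
  refine ⟨_, _, _, _, _, shortExact_cokernel fac.i, rightPerp_of_generatingMonos hG ?_, ?_⟩
  · intro K P i hi f
    have := fac.hp i hi
    have sq : CommSq f i fac.p 0 := ⟨(isZero_zero A).eq_of_tgt _ _⟩
    exact ⟨sq.lift, sq.fac_left⟩
  · refine fun Y hY => .of_split fun E i p w hS => ?_
    have : Epi p := hS.epi_g
    have e : kernel p ≅ Y :=
      (kernelIsKernel _).conePointUniqueUpToIso hS.fIsKernel
    have := fac.hi p (generatingMonos_rlp_of_epi p
      ((rightPerp T).prop_of_iso e.symm hY))
    have sq : CommSq 0 fac.i p (cokernel.π fac.i) := ⟨by simp⟩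
    refine ⟨cokernel.desc _ sq.lift sq.fac_left, ?_⟩
    rw [← cancel_epi (cokernel.π fac.i)]
    simp

end SmallObject

/-! ### Salce's exchange argument -/

section Salce

variable {A : Type u} [Category.{v} A] [Abelian A]

/-- If every object is a quotient of an object of the left class and embeds in an object of the
right class with a cokernel in the left class, then the cotorsion pair is complete. -/
lemma IsCotorsionPair.isComplete {F D : ObjectProperty A} (h : IsCotorsionPair F D)
    (h₁ : ∀ M : A, ∃ (P : A) (p : P ⟶ M), F P ∧ Epi p)
    (h₂ : ∀ M : A, ∃ (Q P : A) (i : M ⟶ Q) (q : Q ⟶ P) (w : i ≫ q = 0),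
      (ShortComplex.mk i q w).ShortExact ∧ D Q ∧ F P) :
    IsCompleteCotorsionPair F D where
  toIsCotorsionPair := h
  enough_injectives M := by
    obtain ⟨Q, P, i, q, w, hS, hQ, hP⟩ := h₂ M
    exact ⟨_, hS, rfl, hQ, hP⟩
  enough_projectives M := by
    obtain ⟨P, p, hP, _⟩ := h₁ M
    obtain ⟨Q, P', i, q, w, hS, hQ, hP'⟩ := h₂ (kernel p)
    have hp := IsPushout.of_hasPushout (kernel.ι p) i
    obtain ⟨a, ha, -, hS₁⟩ := shortExact_of_isPushout (shortExact_kernel p) hp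
    obtain ⟨b, hb, -, hS₂⟩ := shortExact_of_isPushout hS hp.flip
    exact ⟨_, hS₁, rfl, (h.left_ext hS₂ hP hP' :), hQ⟩

lemma IsCompleteCotorsionPair.exists_right {F D : ObjectProperty A}
    (h : IsCompleteCotorsionPair F D) (M : A) :
    ∃ (Q P : A) (i : M ⟶ Q) (q : Q ⟶ P) (w : i ≫ q = 0),
      (ShortComplex.mk i q w).ShortExact ∧ D Q ∧ F P := by
  obtain ⟨S, hS, rfl, hQ, hP⟩ := h.enough_injectives M
  exact ⟨_, _, _, _, _, hS, hQ, hP⟩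

lemma IsCompleteCotorsionPair.exists_left {F D : ObjectProperty A}
    (h : IsCompleteCotorsionPair F D) (M : A) :
    ∃ (Q P : A) (i : Q ⟶ P) (p : P ⟶ M) (w : i ≫ p = 0),
      (ShortComplex.mk i p w).ShortExact ∧ D Q ∧ F P := by
  obtain ⟨S, hS, rfl, hP, hQ⟩ := h.enough_projectives M
  exact ⟨_, _, _, _, _, hS, hQ, hP⟩

/-- In a Grothendieck abelian category, a cotorsion pair which is cogenerated by a set is complete
if every object is a quotient of an object of the left class. -/
theorem isCompleteCotorsionPair_of_small {A : Type u} [Category.{v} A] [Abelian A]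
    [IsGrothendieckAbelian.{v} A] (T : ObjectProperty A) [ObjectProperty.Small.{v} T]
    (h₁ : ∀ M : A, ∃ (P : A) (p : P ⟶ M), leftPerp (rightPerp T) P ∧ Epi p) :
    IsCompleteCotorsionPair (leftPerp (rightPerp T)) (rightPerp T) :=
  (isCotorsionPair_leftPerp_rightPerp T).isComplete h₁ (exists_rightPerp_embedding T)

end Salce

/-! ### Exactness of the Hom complex and extensions of complexes -/

section HomComplex

open CochainComplex HomComplex ZeroObject

variable {A : Type u} [Category.{v} A] [Abelian A]

lemma homComplex_acyclic_iff (X Y : CochainComplex A ℤ) :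
    (HomComplex X Y).Acyclic ↔ ∀ (n : ℤ) (z : Cochain X Y n), δ n (n + 1) z = 0 →
      ∃ y : Cochain X Y (n - 1), δ (n - 1) n y = z := by
  refine forall_congr' fun n => ?_
  rw [HomologicalComplex.exactAt_iff' _ (n - 1) n (n + 1) (by simp) (by simp),
    ShortComplex.ab_exact_iff]
  rfl

lemma exists_δ_eq_of_acyclic {X Y : CochainComplex A ℤ} (h : (HomComplex X Y).Acyclic)
    {n m : ℤ} (hnm : n + 1 = m) (z : Cocycle X Y m) : ∃ y : Cochain X Y n, δ n m y = z.1 := by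
  obtain rfl : n = m - 1 := by lia
  exact (homComplex_acyclic_iff X Y).1 h m z.1 (z.δ_eq_zero _)

/-- The Hom complex is exact if all morphisms to the shifts of the target are null-homotopic. -/
lemma homComplex_acyclic_of_shift_right {X Y : CochainComplex A ℤ}
    (h : ∀ (n : ℤ) (f : X ⟶ Y⟦n⟧), Nonempty (Homotopy f 0)) : (HomComplex X Y).Acyclic := by
  refine (homComplex_acyclic_iff X Y).2 fun n z hz => ?_
  obtain ⟨φ, hφ⟩ := (Cocycle.equivHom ..).surjective
    ((Cocycle.mk z _ rfl hz).rightShift n 0 (zero_add n))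
  replace hφ : Cochain.ofHom φ = z.rightShift n 0 (zero_add n) := by
    simpa using congrArg Subtype.val hφ
  obtain ⟨h⟩ := h n φ
  obtain ⟨f, hf⟩ := Cochain.equivHomotopy _ _ h
  simp only [Int.reduceNeg, Cochain.ofHom_zero, add_zero] at hf
  refine ⟨n.negOnePow • Cochain.rightUnshift f (n - 1) (by lia), ?_⟩
  apply (Cochain.rightShiftAddEquiv _ _ _ n 0 (by simp)).injective
  change Cochain.rightShift _ n 0 (zero_add n) = Cochain.rightShift _ n 0 (zero_add n)
  rw [← hφ, hf, δ_units_smul, Cochain.rightShift_units_smul,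
    Cochain.δ_rightUnshift _ _ _ _ 0 (by simp)]
  simp [smul_smul]

lemma homotopy_of_acyclic {X Y : CochainComplex A ℤ} (h : (HomComplex X Y).Acyclic)
    (f : X ⟶ Y) : Nonempty (Homotopy f 0) := by
  obtain ⟨y, hy⟩ := exists_δ_eq_of_acyclic h (neg_add_cancel 1) (Cocycle.ofHom f)
  exact ⟨(Cochain.equivHomotopy f 0).symm ⟨y, by simpa using hy.symm⟩⟩

/-- The Hom complex is exact if all morphisms from the shifts of the source are null-homotopic. -/
lemma homComplex_acyclic_of_shift_left {X Y : CochainComplex A ℤ}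
    (h : ∀ (n : ℤ) (f : X⟦n⟧ ⟶ Y), Nonempty (Homotopy f 0)) : (HomComplex X Y).Acyclic := by
  refine homComplex_acyclic_of_shift_right fun n f => ?_
  let Φ := HomotopyCategory.quotient A (ComplexShape.up ℤ)
  refine ⟨HomotopyCategory.homotopyOfEq _ _ ?_⟩
  obtain ⟨H⟩ := h (-n) (f⟦-n⟧' ≫ (shiftShiftNeg Y n).hom)
  have h1 : Φ.map (f⟦-n⟧') = 0 := by
    have := HomotopyCategory.eq_of_homotopy _ _ H
    rw [Functor.map_zero, Functor.map_comp] at this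
    exact (cancel_mono (Φ.map (shiftShiftNeg Y n).hom)).1 (by rw [this, zero_comp])
  have h2 : (Φ.map f)⟦-n⟧' = 0 := by
    have := (Φ.commShiftIso (-n)).hom.naturality f
    dsimp at this
    rw [← cancel_epi ((Φ.commShiftIso (-n)).hom.app X), ← this, comp_zero]
    simp [h1]
  apply (CategoryTheory.shiftFunctor (HomotopyCategory A (ComplexShape.up ℤ)) (-n)).map_injective
  rw [h2, Functor.map_zero, Functor.map_zero]

/-- If the components of `X` and `Y` have no extensions and the Hom complex is exact, then `X` has
no extensions by `Y`: such an extension splits in each degree, and the obstruction to splitting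
is a cocycle of the Hom complex. -/
lemma ExtOneVanishes.of_homComplex_acyclic [EnoughInjectives (CochainComplex A ℤ)]
    {X Y : CochainComplex A ℤ} (h₁ : ∀ n, ExtOneVanishes (X.X n) (Y.X n))
    (h₂ : (HomComplex X Y).Acyclic) : ExtOneVanishes X Y := by
  refine .of_split fun E i p w hS => ?_
  have sq : CommSq (0 : (0 : CochainComplex A ℤ) ⟶ E) 0 p (𝟙 X) := ⟨by simp⟩
  have (n : ℤ) : ∃ s : X.X n ⟶ E.X n, s ≫ p.f n = 𝟙 _ :=
    (h₁ n).exists_section ((HomologicalComplex.shortExact_iff_degreewise_shortExact _).1 hS n)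
  choose s hs using this
  have hsq (n : ℤ) : (sq.map (HomologicalComplex.eval _ _ n)).LiftStruct :=
    { l := s n
      fac_left := ((HomologicalComplex.eval A _ n).map_isZero
        (isZero_zero (CochainComplex A ℤ))).eq_of_src _ _
      fac_right := hs n }
  have hQ : IsColimit (CokernelCofork.ofπ (f := (0 : (0 : CochainComplex A ℤ) ⟶ X)) (𝟙 X)
      (by simp)) := CokernelCofork.IsColimit.ofId _ rfl
  obtain ⟨α, hα⟩ := exists_δ_eq_of_acyclic h₂ (zero_add 1)
    (Lifting.cocycle₁ sq hsq hQ hS.fIsKernel)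
  have := Lifting.hasLift sq hsq hQ hS.fIsKernel α hα
  exact ⟨sq.lift, sq.fac_right⟩

/-- If `X` has no extensions by `Y`, then every morphism from `X` to the shift of `Y` lifts to the
cone of the identity of `Y`, hence is null-homotopic. -/
lemma ExtOneVanishes.homotopy {X Y : CochainComplex A ℤ} (h : ExtOneVanishes X Y)
    (f : X ⟶ Y⟦(1 : ℤ)⟧) : Nonempty (Homotopy f 0) := by
  have hS : (mappingCone.triangleRotateShortComplex (𝟙 Y)).ShortExact :=
    HomologicalComplex.shortExact_of_degreewise_shortExact _
      fun n => (mappingCone.triangleRotateShortComplexSplitting (𝟙 Y) n).shortExact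
  obtain ⟨g, π, rfl⟩ : ∃ (g : X ⟶ mappingCone (𝟙 Y)) (π : mappingCone (𝟙 Y) ⟶ Y⟦(1 : ℤ)⟧),
      g ≫ π = f :=
    have ⟨g, hg⟩ := h.exists_lift hS f
    ⟨g, _, hg⟩
  exact ⟨((Homotopy.ofEq (by simp)).trans
    (((mappingCone.homotopyToZeroOfId Y).compLeft g).compRight π)).trans (.ofEq (by simp))⟩

end HomComplex

section HomComplex

open CochainComplex HomComplex

variable {A : Type u} [Category.{v} A] [Abelian A]

lemma homComplex_acyclic_of_shift {X Y : CochainComplex A ℤ} (a : ℤ)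
    (h : (HomComplex X (Y⟦a⟧)).Acyclic) : (HomComplex X Y).Acyclic := by
  refine (homComplex_acyclic_iff X Y).2 fun n z hz => ?_
  have hz' := Cochain.δ_rightShift z a (n - a) (n - a + 1) (by lia) (n + 1) (by lia)
  rw [hz, Cochain.rightShift_zero, smul_zero] at hz'
  obtain ⟨y, hy⟩ := (homComplex_acyclic_iff _ _).1 h (n - a) _ hz'
  refine ⟨a.negOnePow • y.rightUnshift (n - 1) (by lia), ?_⟩
  apply (Cochain.rightShiftAddEquiv _ _ _ a (n - a) (by lia)).injective
  change Cochain.rightShift _ a (n - a) (by lia) = Cochain.rightShift _ a (n - a) (by lia)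
  rw [← hy, δ_units_smul, Cochain.rightShift_units_smul,
    Cochain.δ_rightUnshift _ _ _ _ (n - a) (by lia)]
  simp [smul_smul]

lemma homComplex_acyclic_of_iso_right {X Y Y' : CochainComplex A ℤ} (e : Y ≅ Y')
    (h : (HomComplex X Y).Acyclic) : (HomComplex X Y').Acyclic := by
  refine (homComplex_acyclic_iff X Y').2 fun n z hz => ?_
  obtain ⟨y, hy⟩ := (homComplex_acyclic_iff _ _).1 h n (z.comp (.ofHom e.inv) (add_zero n))
    (by simp [hz])
  exact ⟨y.comp (.ofHom e.hom) (add_zero _), by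
    rw [δ_comp_ofHom, hy, Cochain.comp_assoc_of_second_is_zero_cochain, ← Cochain.ofHom_comp,
      e.inv_hom_id, Cochain.comp_id]⟩

lemma homComplex_acyclic_shift {X Y : CochainComplex A ℤ} (h : (HomComplex X Y).Acyclic)
    (a : ℤ) : (HomComplex X (Y⟦a⟧)).Acyclic :=
  homComplex_acyclic_of_shift (-a) (homComplex_acyclic_of_iso_right (shiftShiftNeg Y a).symm h)

/-- If all shifts of `X` have no extensions by `Y`, then the Hom complex is exact. -/
lemma homComplex_acyclic_of_extOneVanishes_left {X Y : CochainComplex A ℤ}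
    (h : ∀ n : ℤ, ExtOneVanishes (X⟦n⟧) Y) : (HomComplex X Y).Acyclic :=
  homComplex_acyclic_of_shift 1 (homComplex_acyclic_of_shift_left fun n f => (h n).homotopy f)

/-- If `X` has no extensions by all shifts of `Y`, then the Hom complex is exact. -/
lemma homComplex_acyclic_of_extOneVanishes_right {X Y : CochainComplex A ℤ}
    (h : ∀ n : ℤ, ExtOneVanishes X (Y⟦n⟧)) : (HomComplex X Y).Acyclic :=
  homComplex_acyclic_of_shift_right fun n f => by
    let e := (CategoryTheory.shiftFunctorAdd' (CochainComplex A ℤ) (n - 1) 1 n (by lia)).app Y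
    obtain ⟨H⟩ := (h (n - 1)).homotopy (f ≫ e.hom)
    exact ⟨((Homotopy.ofEq (by simp)).trans (H.compRight e.inv)).trans (.ofEq (by simp))⟩

/-- The Hom complex from an object in a single degree is, up to shift, `Hom(T, Y)`. -/
lemma exists_comp_d_eq_of_acyclic {T : A} {Y : CochainComplex A ℤ} {p : ℤ}
    (h : (HomComplex ((singleFunctor A p).obj T) Y).Acyclic) {m n k : ℤ} (hm : m + 1 = n)
    (hk : n + 1 = k) (f : T ⟶ Y.X n) (hf : f ≫ Y.d n k = 0) : ∃ g, g ≫ Y.d m n = f := by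
  obtain ⟨y, hy⟩ := exists_δ_eq_of_acyclic h (n := m - p) (by lia)
    (Cocycle.fromSingleMk f (show p + (n - p) = n by lia) k hk hf)
  obtain ⟨g, rfl⟩ := Cochain.fromSingleMk_surjective y m (by lia)
  rw [Cochain.δ_fromSingleMk g (by lia) (n - p) n (by lia)] at hy
  exact ⟨g, (Cochain.fromSingleEquiv (show p + (n - p) = n by lia)).symm.injective hy⟩

/-- The Hom complex to an object in a single degree is, up to shift and signs, `Hom(X, C)`. -/
lemma exists_d_comp_eq_of_acyclic {X : CochainComplex A ℤ} {C : A} {q : ℤ}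
    (h : (HomComplex X ((singleFunctor A q).obj C)).Acyclic) {m n k : ℤ} (hm : m + 1 = n)
    (hk : n + 1 = k) (f : X.X n ⟶ C) (hf : X.d m n ≫ f = 0) : ∃ g, X.d n k ≫ g = f := by
  obtain ⟨y, hy⟩ := exists_δ_eq_of_acyclic h (n := q - k) (by lia)
    (Cocycle.toSingleMk f (show n + (q - n) = q by lia) m hm hf)
  obtain ⟨g, rfl⟩ := Cochain.toSingleMk_surjective y k (by lia)
  rw [Cochain.δ_toSingleMk g (by lia) (q - n) n (by lia)] at hy
  refine ⟨(q - n).negOnePow • g, ?_⟩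
  have := congrArg (Cochain.toSingleEquiv (show n + (q - n) = q by lia)) hy
  rw [Units.smul_def, map_zsmul, Cochain.toSingleEquiv_toSingleMk, ← Units.smul_def] at this
  rw [Linear.comp_units_smul, this]
  exact Cochain.toSingleEquiv_toSingleMk _ _

/-- The Hom complex from a complex with zero differential is exact if all the complexes of
morphisms from its components are. -/
lemma homComplex_acyclic_of_d_eq_zero_left {X Y : CochainComplex A ℤ} (hX : ∀ i j, X.d i j = 0)
    (h : ∀ (p : ℤ) ⦃m n k : ℤ⦄, m + 1 = n → n + 1 = k → ∀ f : X.X p ⟶ Y.X n,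
      f ≫ Y.d n k = 0 → ∃ g, g ≫ Y.d m n = f) : (HomComplex X Y).Acyclic := by
  refine (homComplex_acyclic_iff X Y).2 fun n z hz => ?_
  have (p m q : ℤ) (hpq : p + n = q) (hm : m + 1 = q) : ∃ g, g ≫ Y.d m q = z.v p q hpq := by
    refine h p hm rfl _ ?_
    have := Cochain.congr_v hz p (q + 1) (by lia)
    rw [δ_v n (n + 1) rfl z p (q + 1) (by lia) q (p + 1) (by lia) rfl, hX] at this
    simpa using this
  choose g hg using this
  refine ⟨.mk fun p m hpm => g p m (m + 1) (by lia) rfl, ?_⟩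
  ext p q hpq
  obtain ⟨m, rfl⟩ : ∃ m, q = m + 1 := ⟨q - 1, by lia⟩
  rw [δ_v (n - 1) n (by lia) _ p (m + 1) hpq m (p + 1) (by lia) rfl, hX, zero_comp, smul_zero,
    add_zero, Cochain.mk_v, hg]

/-- The Hom complex to a complex with zero differential is exact if all the complexes of
morphisms to its components are. -/
lemma homComplex_acyclic_of_d_eq_zero_right {X Y : CochainComplex A ℤ} (hY : ∀ i j, Y.d i j = 0)
    (h : ∀ (p : ℤ) ⦃m n k : ℤ⦄, m + 1 = n → n + 1 = k → ∀ f : X.X n ⟶ Y.X p,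
      X.d m n ≫ f = 0 → ∃ g, X.d n k ≫ g = f) : (HomComplex X Y).Acyclic := by
  refine (homComplex_acyclic_iff X Y).2 fun n z hz => ?_
  have (p k q : ℤ) (hpq : p + n = q) (hk : p + 1 = k) : ∃ g, X.d p k ≫ g = z.v p q hpq := by
    refine h q (sub_add_cancel p 1) hk _ ?_
    have := Cochain.congr_v hz (p - 1) q (by lia)
    rw [δ_v n (n + 1) rfl z (p - 1) q (by lia) (q - 1) p rfl (by lia), hY] at this
    simpa [smul_eq_zero_iff_eq] using this
  choose g hg using this
  refine ⟨n.negOnePow • .mk fun k q hkq => g (k - 1) k q (by lia) (by lia), ?_⟩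
  ext p q hpq
  obtain ⟨k, rfl⟩ : ∃ k, p = k - 1 := ⟨p + 1, by lia⟩
  rw [δ_units_smul, Cochain.units_smul_v, δ_v (n - 1) n (by lia) _ (k - 1) q hpq (q - 1) k rfl
    (by lia), hY, comp_zero, zero_add, Cochain.mk_v, hg, smul_smul]
  simp

end HomComplex

/-! ### Cycles of acyclic complexes -/

section Cycles

open CochainComplex HomologicalComplex

variable {A : Type u} [Category.{v} A] [Abelian A]

lemma exactAt_iff_epi_toCycles (X : CochainComplex A ℤ) {m n : ℤ} (hmn : m + 1 = n) :
    X.ExactAt n ↔ Epi (X.toCycles m n) := by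
  rw [X.exactAt_iff' m n (n + 1) (by simp [← hmn]) (by simp), ShortComplex.exact_iff_epi_toCycles,
    ← toCycles_cyclesIsoSc'_hom _ _ _ _ (by simp [← hmn]) (by simp)]
  exact (MorphismProperty.epimorphisms A).cancel_right_of_respectsIso _ _

lemma iCycles_toCycles (X : CochainComplex A ℤ) (m n : ℤ) :
    X.iCycles m ≫ X.toCycles m n = 0 := by
  rw [← cancel_mono (X.iCycles n)]
  simp

lemma shortExact_cycles {X : CochainComplex A ℤ} (hX : X.Acyclic) {m n : ℤ} (hmn : m + 1 = n) :
    (ShortComplex.mk (X.iCycles m) (X.toCycles m n) (iCycles_toCycles X m n)).ShortExact := by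
  have : Epi (X.toCycles m n) := (exactAt_iff_epi_toCycles X hmn).1 (hX n)
  exact
    { exact := ShortComplex.exact_of_f_is_kernel _ (isKernelOfComp (X.iCycles n) (X.d m n)
        (X.cyclesIsKernel m n (by simp [← hmn])) (by simp [← cancel_mono (X.iCycles n)])
        (by simp)) }

/-- `Hom(T, Y)` is exact if `Y` is acyclic and `Ext¹(T, -)` vanishes on the cycles of `Y`. -/
lemma exists_comp_d_eq {T : A} {Y : CochainComplex A ℤ} (hY : Y.Acyclic)
    (h : ∀ n, ExtOneVanishes T (Y.cycles n)) {m n k : ℤ} (hm : m + 1 = n) (hk : n + 1 = k)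
    (f : T ⟶ Y.X n) (hf : f ≫ Y.d n k = 0) : ∃ g, g ≫ Y.d m n = f := by
  obtain ⟨g, hg⟩ := (h m).exists_lift (shortExact_cycles hY hm)
    (Y.liftCycles f k (by simp [← hk]) hf)
  exact ⟨g, by rw [← Y.toCycles_i, reassoc_of% hg, liftCycles_i]⟩

/-- `Hom(X, C)` is exact if `X` is acyclic and `Ext¹(-, C)` vanishes on the cycles of `X`. -/
lemma exists_d_comp_eq {X : CochainComplex A ℤ} {C : A} (hX : X.Acyclic)
    (h : ∀ n, ExtOneVanishes (X.cycles n) C) {m n k : ℤ} (hm : m + 1 = n) (hk : n + 1 = k)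
    (f : X.X n ⟶ C) (hf : X.d m n ≫ f = 0) : ∃ g, X.d n k ≫ g = f := by
  have := (shortExact_cycles hX hm).epi_g
  obtain ⟨f', hf'⟩ := CokernelCofork.IsColimit.desc' (shortExact_cycles hX hk).gIsCokernel f
    (by rw [← cancel_epi (X.toCycles m n)]; simpa using hf)
  obtain ⟨g, hg⟩ := (h (k + 1)).exists_extension (shortExact_cycles hX rfl) f'
  dsimp at hf' hg
  exact ⟨g, by rw [← X.toCycles_i, Category.assoc, hg, hf']⟩

/-- A complex is acyclic if the complex of morphisms from a separator to it is exact. -/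
lemma acyclic_of_isSeparator {G : A} (hG : IsSeparator G) {Y : CochainComplex A ℤ}
    (h : ∀ ⦃m n k : ℤ⦄, m + 1 = n → n + 1 = k → ∀ f : G ⟶ Y.X n, f ≫ Y.d n k = 0 →
      ∃ g, g ≫ Y.d m n = f) : Y.Acyclic := fun n => by
  rw [exactAt_iff_epi_toCycles Y (sub_add_cancel n 1)]
  refine ⟨fun {Z} a b hab => hG.def _ _ fun f => ?_⟩
  obtain ⟨g, hg⟩ := h (sub_add_cancel n 1) rfl (f ≫ Y.iCycles n) (by simp)
  obtain rfl : g ≫ Y.toCycles (n - 1) n = f := by simpa [← cancel_mono (Y.iCycles n)] using hg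
  rw [Category.assoc, Category.assoc, hab]

/-- A converse to `exists_comp_d_eq`: exactness of `Hom(T, Y)` at one place makes `Ext¹(T, -)`
vanish on the preceding cycles. -/
lemma ExtOneVanishes.cycles_right {T : A} {Y : CochainComplex A ℤ} (hY : Y.Acyclic) {m n : ℤ}
    (hm : m + 1 = n) (k : ℤ) (hT : ExtOneVanishes T (Y.X m))
    (h : ∀ f : T ⟶ Y.X n, f ≫ Y.d n k = 0 → ∃ g, g ≫ Y.d m n = f) :
    ExtOneVanishes T (Y.cycles m) := by
  refine .of_lift (shortExact_cycles hY hm) hT fun f => ?_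
  obtain ⟨g, hg⟩ := h (f ≫ Y.iCycles n) (by simp)
  exact ⟨g, by simpa [← cancel_mono (Y.iCycles n)] using hg⟩

/-- Exactness can be tested by morphisms to injective objects. -/
lemma exact_of_injective [EnoughInjectives A] {S : ShortComplex A}
    (h : ∀ (I : A), Injective I → ∀ f : S.X₂ ⟶ I, S.f ≫ f = 0 → ∃ g, S.g ≫ g = f) : S.Exact := by
  rw [ShortComplex.exact_iff_mono_fromOpcycles]
  obtain ⟨g, hg⟩ := h (Injective.under S.opcycles) inferInstance
    (S.pOpcycles ≫ Injective.ι _) (by simp)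
  have : S.fromOpcycles ≫ g = Injective.ι _ := by
    rw [← cancel_epi S.pOpcycles, S.p_fromOpcycles_assoc, hg]
  have : Mono (S.fromOpcycles ≫ g) := by
    rw [this]
    infer_instance
  exact mono_of_mono _ g

lemma acyclic_of_injective [EnoughInjectives A] {X : CochainComplex A ℤ}
    (h : ∀ (I : A), Injective I → ∀ ⦃m n k : ℤ⦄, m + 1 = n → n + 1 = k → ∀ f : X.X n ⟶ I,
      X.d m n ≫ f = 0 → ∃ g, X.d n k ≫ g = f) : X.Acyclic := fun n => by
  rw [X.exactAt_iff' (n - 1) n (n + 1) (by simp) (by simp)]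
  exact exact_of_injective fun I hI f hf => h I hI (sub_add_cancel n 1) rfl f hf

/-- A converse to `exists_d_comp_eq`. -/
lemma ExtOneVanishes.cycles_left {X : CochainComplex A ℤ} {C : A} (hX : X.Acyclic)
    (hC : ∀ n, ExtOneVanishes (X.X n) C) (h : ∀ ⦃m n k : ℤ⦄, m + 1 = n → n + 1 = k →
      ∀ f : X.X n ⟶ C, X.d m n ≫ f = 0 → ∃ g, X.d n k ≫ g = f) (n : ℤ) :
    ExtOneVanishes (X.cycles n) C := by
  refine .of_extension (shortExact_cycles hX (sub_add_cancel n 1)) (hC _)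
    fun (f : X.cycles (n - 1) ⟶ C) => ?_
  have : Epi (X.toCycles (n - 1 - 1) (n - 1)) :=
    (shortExact_cycles hX (sub_add_cancel (n - 1) 1)).epi_g
  obtain ⟨g, hg⟩ := h (sub_add_cancel (n - 1 - 1) 1) (sub_add_cancel (n - 1) 1)
    (X.toCycles (n - 1 - 1) (n - 1) ≫ f) (by rw [d_toCycles_assoc, zero_comp])
  exact ⟨g, by rw [← cancel_epi (X.toCycles (n - 1 - 1) (n - 1)), ← hg, X.toCycles_i_assoc]⟩

lemma acyclic_shift {X : CochainComplex A ℤ} (hX : X.Acyclic) (a : ℤ) : (X⟦a⟧).Acyclic :=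
  fun n => (ShortComplex.exact_iff_of_iso
    ((shiftShortComplexFunctorIso A a n (a + n) rfl).app X)).2 (hX (a + n))

lemma tilde_shift {L : ObjectProperty A} [L.IsClosedUnderIsomorphisms] {X : CochainComplex A ℤ}
    (hX : tilde L X) (a : ℤ) : tilde L (X⟦a⟧) :=
  ⟨acyclic_shift hX.1 a, fun n => L.prop_of_iso (ShortComplex.cyclesMapIso
    ((shiftShortComplexFunctorIso A a n (a + n) rfl).app X)).symm (hX.2 (a + n))⟩

lemma tilde_prop_X {L : ObjectProperty A} (hL : ∀ ⦃S : ShortComplex A⦄, S.ShortExact →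
    L S.X₁ → L S.X₃ → L S.X₂) {X : CochainComplex A ℤ} (hX : tilde L X) (n : ℤ) : L (X.X n) :=
  hL (shortExact_cycles hX.1 rfl) (hX.2 n) (hX.2 (n + 1))

end Cycles

/-! ### Disc complexes -/

section Disc

open CochainComplex HomologicalComplex

variable {A : Type u} [Category.{v} A] [Abelian A]

/-- The disc complex `⋯ → 0 → M → M → 0 → ⋯`, with identity differential, in the
degrees `n` and `n + 1`. -/
noncomputable def disc (n : ℤ) (M : A) : CochainComplex A ℤ :=
  double (𝟙 M) (show (ComplexShape.up ℤ).Rel n (n + 1) from rfl)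

/-- Morphisms from a disc. -/
noncomputable def fromDisc {n : ℤ} {M : A} {X : CochainComplex A ℤ} (f : M ⟶ X.X n) :
    disc n M ⟶ X :=
  mkHomFromDouble _ (by simp) f (f ≫ X.d n (n + 1)) (by simp) (by simp)

/-- The isomorphism between `M` and the first nonzero component of the disc. -/
noncomputable def discXIso₀ (n : ℤ) (M : A) : (disc n M).X n ≅ M :=
  doubleXIso₀ (𝟙 M) (show (ComplexShape.up ℤ).Rel n (n + 1) from rfl)

/-- The isomorphism between `M` and the second nonzero component of the disc. -/
noncomputable def discXIso₁ (n : ℤ) (M : A) : (disc n M).X (n + 1) ≅ M :=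
  doubleXIso₁ (𝟙 M) (show (ComplexShape.up ℤ).Rel n (n + 1) from rfl) (by simp)

lemma disc_d (n : ℤ) (M : A) :
    (disc n M).d n (n + 1) = (discXIso₀ n M).hom ≫ (discXIso₁ n M).inv := by
  refine (double_d (𝟙 M) (show (ComplexShape.up ℤ).Rel n (n + 1) from rfl) (by simp)).trans ?_
  rw [Category.id_comp]
  rfl

@[simp]
lemma fromDisc_f₀ {n : ℤ} {M : A} {X : CochainComplex A ℤ} (f : M ⟶ X.X n) :
    (fromDisc f).f n = (discXIso₀ n M).hom ≫ f :=
  mkHomFromDouble_f₀ ..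

lemma fromDisc_ext {n : ℤ} {M : A} {X : CochainComplex A ℤ} {φ ψ : disc n M ⟶ X}
    (h : φ.f n = ψ.f n) : φ = ψ := by
  refine from_double_hom_ext h ?_
  have : IsIso ((disc n M).d n (n + 1)) := by rw [disc_d]; infer_instance
  change (_ : (disc n M).X _ ⟶ _) = _
  rw [← cancel_epi ((disc n M).d n (n + 1)), ← φ.comm, ← ψ.comm, h]

lemma isZero_disc_X {n : ℤ} (M : A) {k : ℤ} (h₀ : k ≠ n) (h₁ : k ≠ n + 1) :
    IsZero ((disc n M).X k) :=
  isZero_double_X _ _ _ h₀ h₁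

open scoped Classical in
/-- Morphisms to a disc. -/
noncomputable def toDisc {n : ℤ} {M : A} {X : CochainComplex A ℤ} (f : X.X (n + 1) ⟶ M) :
    X ⟶ disc n M where
  f k := if h₁ : k = n + 1 then (X.XIsoOfEq h₁).hom ≫ f ≫ (discXIso₁ n M).inv ≫
      ((disc n M).XIsoOfEq h₁).inv
    else if h₀ : k = n then (X.XIsoOfEq h₀).hom ≫ X.d n (n + 1) ≫ f ≫ (discXIso₀ n M).inv ≫
      ((disc n M).XIsoOfEq h₀).inv
    else 0
  comm' i j hij := by
    obtain rfl : i + 1 = j := hij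
    by_cases h₁ : i = n
    · subst h₁
      simp [disc_d]
    by_cases h₀ : i + 1 = n
    · subst h₀
      have : (disc (i + 1) M).d i (i + 1) = 0 := (isZero_disc_X M (by lia) (by lia)).eq_of_src _ _
      simp [this]
    · exact (isZero_disc_X M h₀ (by lia)).eq_of_tgt _ _

@[simp]
lemma toDisc_f₁ {n : ℤ} {M : A} {X : CochainComplex A ℤ} (f : X.X (n + 1) ⟶ M) :
    (toDisc f).f (n + 1) = f ≫ (discXIso₁ n M).inv := by
  simp [toDisc]

/-- The functoriality of discs. -/
noncomputable def discMap (n : ℤ) {M N : A} (f : M ⟶ N) : disc n M ⟶ disc n N :=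
  fromDisc (f ≫ (discXIso₀ n N).inv)

lemma discMap_f₀ (n : ℤ) {M N : A} (f : M ⟶ N) :
    (discMap n f).f n = (discXIso₀ n M).hom ≫ f ≫ (discXIso₀ n N).inv :=
  fromDisc_f₀ _

lemma discMap_f₁ (n : ℤ) {M N : A} (f : M ⟶ N) :
    (discMap n f).f (n + 1) = (discXIso₁ n M).hom ≫ f ≫ (discXIso₁ n N).inv := by
  have := (discMap n f).comm n (n + 1)
  rw [disc_d, disc_d, discMap_f₀] at this
  rw [← cancel_epi ((discXIso₀ n M).hom ≫ (discXIso₁ n M).inv), ← this]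
  simp

lemma discXIso₀_inv_discMap (n : ℤ) {M N : A} (f : M ⟶ N) :
    (discXIso₀ n M).inv ≫ (discMap n f).f n = f ≫ (discXIso₀ n N).inv := by
  rw [discMap_f₀, Iso.inv_hom_id_assoc]

lemma discXIso₁_inv_discMap (n : ℤ) {M N : A} (f : M ⟶ N) :
    (discXIso₁ n M).inv ≫ (discMap n f).f (n + 1) = f ≫ (discXIso₁ n N).inv := by
  rw [discMap_f₁, Iso.inv_hom_id_assoc]

lemma shortExact_discMap (n : ℤ) {S : ShortComplex A} (hS : S.ShortExact) :
    (ShortComplex.mk (discMap n S.f) (discMap n S.g)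
      (fromDisc_ext (by simp [discMap_f₀]))).ShortExact := by
  refine HomologicalComplex.shortExact_of_degreewise_shortExact _ fun k => ?_
  by_cases h₀ : k = n
  · subst h₀
    exact ShortComplex.shortExact_of_iso (ShortComplex.isoMk (discXIso₀ k _).symm
      (discXIso₀ k _).symm (discXIso₀ k _).symm (discXIso₀_inv_discMap ..)
      (discXIso₀_inv_discMap ..)) hS
  by_cases h₁ : k = n + 1
  · subst h₁
    exact ShortComplex.shortExact_of_iso (ShortComplex.isoMk (discXIso₁ n _).symm
      (discXIso₁ n _).symm (discXIso₁ n _).symm (discXIso₁_inv_discMap ..)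
      (discXIso₁_inv_discMap ..)) hS
  · have h := isZero_disc_X (n := n) S.X₂ h₀ h₁
    exact
      { exact := ShortComplex.exact_of_isZero_X₂ _ h
        mono_f := (isZero_disc_X (n := n) S.X₁ h₀ h₁).mono _
        epi_g := (isZero_disc_X (n := n) S.X₃ h₀ h₁).epi _ }

lemma isIso_toCycles_disc (n : ℤ) (M : A) : IsIso ((disc n M).toCycles n (n + 1)) := by
  have : IsIso ((disc n M).toCycles n (n + 1) ≫ (disc n M).iCycles (n + 1)) := by
    rw [toCycles_i, disc_d]
    infer_instance
  have : Epi ((disc n M).iCycles (n + 1)) :=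
    epi_of_epi ((disc n M).toCycles n (n + 1)) ((disc n M).iCycles (n + 1))
  have : IsIso ((disc n M).iCycles (n + 1)) := isIso_of_mono_of_epi _
  exact IsIso.of_isIso_comp_right _ ((disc n M).iCycles (n + 1))

lemma isZero_cycles_disc {n : ℤ} (M : A) {k : ℤ} (hk : k ≠ n + 1) :
    IsZero ((disc n M).cycles k) := by
  rw [IsZero.iff_id_eq_zero, ← cancel_mono ((disc n M).iCycles k)]
  by_cases h₀ : k = n
  · subst h₀
    have : Mono ((disc k M).d k (k + 1)) := by rw [disc_d]; infer_instance
    simp [← cancel_mono ((disc k M).d k (k + 1))]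
  · exact (isZero_disc_X M h₀ hk).eq_of_tgt _ _

lemma tilde_disc {L : ObjectProperty A} [L.IsClosedUnderIsomorphisms] (h₀ : ∀ Z, IsZero Z → L Z)
    (n : ℤ) {M : A} (hM : L M) : tilde L (disc n M) := by
  have := isIso_toCycles_disc n M
  refine ⟨fun k => ?_, fun k => ?_⟩ <;> obtain rfl | hk := eq_or_ne k (n + 1)
  · rw [exactAt_iff_epi_toCycles _ rfl]
    infer_instance
  · rw [exactAt_iff_epi_toCycles _ (sub_add_cancel k 1)]
    exact (isZero_cycles_disc M hk).epi _
  · exact L.prop_of_iso ((discXIso₀ n M).symm ≪≫ asIso ((disc n M).toCycles n (n + 1))) hM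
  · exact h₀ _ (isZero_cycles_disc M hk)

/-- An extension of the component `X.X (n + 1)` by `C` yields an extension of discs, and its
pullback to `X` splits if `X` has no extensions by the disc on `C`. -/
lemma ExtOneVanishes.of_disc_right [EnoughInjectives A] {X : CochainComplex A ℤ} {C : A} {n : ℤ}
    (h : ExtOneVanishes X (disc n C)) : ExtOneVanishes (X.X (n + 1)) C := by
  refine .of_split fun E i p w hS => ?_
  obtain ⟨s, hs⟩ := h.exists_lift (shortExact_discMap n hS) (toDisc (𝟙 (X.X (n + 1))))
  refine ⟨s.f (n + 1) ≫ (discXIso₁ n E).hom, ?_⟩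
  have := congrArg (fun φ => φ.f (n + 1) ≫ (discXIso₁ n _).hom) hs
  simpa [discMap_f₁] using this

/-- The counterpart of `ExtOneVanishes.of_disc_right` for morphisms from discs. -/
lemma ExtOneVanishes.of_disc_left [EnoughInjectives A] {Y : CochainComplex A ℤ} {T : A} {n : ℤ}
    (h : ExtOneVanishes (disc n T) Y) : ExtOneVanishes T (Y.X n) := by
  refine .of_split fun E i p w hS => ?_
  obtain ⟨r, hr⟩ := h.exists_extension (shortExact_discMap n hS) (fromDisc (𝟙 (Y.X n)))
  have := congrArg (fun φ => (discXIso₀ n _).inv ≫ φ.f n) hr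
  have hr' : i ≫ (discXIso₀ n E).inv ≫ r.f n = 𝟙 _ := by simpa [discMap_f₀] using this
  have σ := ShortComplex.Splitting.ofExactOfRetraction (ShortComplex.mk i p w) hS.exact _ hr'
    hS.epi_g
  exact ⟨σ.s, σ.s_g⟩

/-- Every complex is a quotient of a coproduct of discs on a separator. -/
lemma epi_desc_fromDisc {G : A} (hG : IsSeparator G) (M : CochainComplex A ℤ)
    [HasCoproduct fun x : Σ n : ℤ, (G ⟶ M.X n) => disc x.1 G] :
    Epi (Sigma.desc fun x : Σ n : ℤ, (G ⟶ M.X n) => fromDisc x.2) := by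
  refine epi_of_epi_f _ fun n => ⟨fun a b hab => hG.def _ _ fun g => ?_⟩
  have := congrArg (fun φ => (discXIso₀ n G).inv ≫
    (Sigma.ι (fun x : Σ n : ℤ, (G ⟶ M.X n) => disc x.1 G) ⟨n, g⟩).f n ≫ φ) hab
  simpa only [← comp_f_assoc, Sigma.ι_desc, fromDisc_f₀, Category.assoc,
    Iso.inv_hom_id_assoc] using this

end Disc

/-! ### The cotorsion pairs of complexes induced by a cotorsion pair -/

section Classes

open CochainComplex HomologicalComplex HomComplex

variable {A : Type u} [Category.{v} A] [Abelian A]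

lemma homComplex_single_left_acyclic {T : A} {Y : CochainComplex A ℤ}
    (h : ∀ n, ExtOneVanishes ((singleFunctor A n).obj T) Y) :
    (HomComplex ((singleFunctor A 0).obj T) Y).Acyclic :=
  homComplex_acyclic_of_extOneVanishes_left fun n => (h (-n)).retract_left
    (((singleFunctors A).shiftIso n (-n) 0 (by lia)).app T).retract

lemma homComplex_single_right_acyclic {X : CochainComplex A ℤ} {C : A}
    (h : ∀ n, ExtOneVanishes X ((singleFunctor A n).obj C)) :
    (HomComplex X ((singleFunctor A 0).obj C)).Acyclic :=
  homComplex_acyclic_of_extOneVanishes_right fun n => (h (-n)).retract_right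
    (((singleFunctors A).shiftIso n (-n) 0 (by lia)).app C).retract

lemma prop_single_X {L : ObjectProperty A} [L.IsClosedUnderIsomorphisms]
    (h₀ : ∀ Z, IsZero Z → L Z) {M : A} (hM : L M) (n k : ℤ) :
    L (((singleFunctor A n).obj M).X k) := by
  by_cases hk : k = n
  · subst hk
    exact L.prop_of_iso (singleObjXSelf (.up ℤ) k M).symm hM
  · exact h₀ _ (isZero_single_obj_X (.up ℤ) n M k hk)

/-- A test set for `𝓓~`: the spheres and the discs on the objects in `T`. -/
inductive spheresAndDiscs (T : ObjectProperty A) : ObjectProperty (CochainComplex A ℤ)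
  | sphere (n : ℤ) (M : A) (hM : T M) : spheresAndDiscs T ((singleFunctor A n).obj M)
  | disc (n : ℤ) (M : A) (hM : T M) : spheresAndDiscs T (disc n M)

instance (T : ObjectProperty A) [ObjectProperty.Small.{v} T] :
    ObjectProperty.Small.{v} (spheresAndDiscs T) := by
  have : Small.{v} (Subtype T) := inferInstanceAs (ObjectProperty.Small.{v} T)
  have h : spheresAndDiscs T = ObjectProperty.ofObj
      (fun x : (ℤ × Subtype T) ⊕ (ℤ × Subtype T) => x.elim
        (fun y => (singleFunctor A y.1).obj y.2.1) (fun y => CotorsionPairs.disc y.1 y.2.1)) := by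
    ext X
    refine ⟨?_, ?_⟩
    · rintro (⟨n, M, hM⟩ | ⟨n, M, hM⟩)
      exacts [ObjectProperty.ofObj_apply _ (Sum.inl (n, Subtype.mk M hM)),
        ObjectProperty.ofObj_apply _ (Sum.inr (n, Subtype.mk M hM))]
    · rintro ⟨⟨n, M, hM⟩ | ⟨n, M, hM⟩⟩
      exacts [.sphere n M hM, .disc n M hM]
  rw [h]
  infer_instance

/-- The complex with zero differential formed by the cycles of a complex. -/
@[simps]
noncomputable def cyclesComplex (X : CochainComplex A ℤ) : CochainComplex A ℤ where
  X n := X.cycles n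
  d _ _ := 0

/-- The complex of cycles of an acyclic complex `X` is a subcomplex of `X`, and the quotient is
the shifted complex of cycles. -/
lemma shortExact_cyclesComplex {X : CochainComplex A ℤ} (hX : X.Acyclic) :
    (ShortComplex.mk (X₁ := cyclesComplex X) (X₂ := X)
      (X₃ := { X := fun n => X.cycles (n + 1), d := fun _ _ => 0 })
      (HomologicalComplex.Hom.mk (fun n => X.iCycles n)
        fun i j _ => (X.iCycles_d i j).trans zero_comp.symm)
      (HomologicalComplex.Hom.mk (fun n => X.toCycles n (n + 1)) (by
        rintro i _ rfl
        simp))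
      (HomologicalComplex.hom_ext _ _ fun n => iCycles_toCycles X n (n + 1))).ShortExact :=
  HomologicalComplex.shortExact_of_degreewise_shortExact _ fun _ => shortExact_cycles hX rfl

namespace IsCotorsionPair

variable {F D : ObjectProperty A} (h : IsCotorsionPair F D)

include h

lemma left_of_isZero (Z : A) (hZ : IsZero Z) : F Z :=
  (h.left_iff _).2 fun Y _ => by
    let := HasExt.standard A
    refine (extOneVanishes_iff _ _).2 fun e => ?_
    rw [← Abelian.Ext.mk₀_id_comp e, hZ.eq_of_src (𝟙 Z) 0, Abelian.Ext.mk₀_zero,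
      Abelian.Ext.zero_comp]

lemma right_of_isZero (Z : A) (hZ : IsZero Z) : D Z :=
  have := hZ.injective
  h.right_of_injective Z

lemma homComplex_acyclic_of_d_eq_zero {X Y : CochainComplex A ℤ} (hX : ∀ i j, X.d i j = 0)
    (hXF : ∀ n, F (X.X n)) (hY : tilde D Y) : (HomComplex X Y).Acyclic :=
  homComplex_acyclic_of_d_eq_zero_left hX fun p _ _ _ hm hk f hf =>
    exists_comp_d_eq hY.1 (fun n => h.extOneVanishes (hXF p) (hY.2 n)) hm hk f hf

lemma tilde_right_X {Y : CochainComplex A ℤ} (hY : tilde D Y) (n : ℤ) : D (Y.X n) :=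
  tilde_prop_X (fun _ => h.right_ext) hY n

lemma tilde_left_X {X : CochainComplex A ℤ} (hX : tilde F X) (n : ℤ) : F (X.X n) :=
  tilde_prop_X (fun _ => h.left_ext) hX n

lemma dgRight_single {C : A} (hC : D C) (n : ℤ) : dgRight F D ((singleFunctor A n).obj C) := by
  have := h.right_isStableUnderRetracts
  refine ⟨prop_single_X h.right_of_isZero hC n, fun X hX => ?_⟩
  exact homComplex_acyclic_of_d_eq_zero_right (fun _ _ => rfl) fun p _ _ _ hm hk f hf =>
    exists_d_comp_eq hX.1 (fun n => h.extOneVanishes (hX.2 n)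
      (prop_single_X h.right_of_isZero hC _ _)) hm hk f hf

lemma left_X_of_leftPerp_tilde [EnoughInjectives A] {X : CochainComplex A ℤ}
    (hX : leftPerp (tilde D) X) (n : ℤ) : F (X.X n) := by
  have := h.right_isStableUnderRetracts
  refine (h.left_iff _).2 fun C hC => ?_
  obtain ⟨m, rfl⟩ : ∃ m, n = m + 1 := ⟨n - 1, by lia⟩
  exact (hX _ (tilde_disc h.right_of_isZero m hC)).of_disc_right

variable [EnoughInjectives (CochainComplex A ℤ)]

lemma extOneVanishes_of_d_eq_zero {X Y : CochainComplex A ℤ} (hX : ∀ i j, X.d i j = 0)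
    (hXF : ∀ n, F (X.X n)) (hY : tilde D Y) : ExtOneVanishes X Y :=
  .of_homComplex_acyclic (fun n => h.extOneVanishes (hXF n) (h.tilde_right_X hY n))
    (h.homComplex_acyclic_of_d_eq_zero hX hXF hY)

/-- An acyclic complex with cycles in `𝓕` has no extensions by `𝓓~`: it is an extension of
two complexes with zero differential and with components in `𝓕`. -/
lemma extOneVanishes_tilde {X Y : CochainComplex A ℤ} (hX : tilde F X) (hY : tilde D Y) :
    ExtOneVanishes X Y :=
  .ext_left (shortExact_cyclesComplex hX.1)
    (h.extOneVanishes_of_d_eq_zero (fun _ _ => rfl) hX.2 hY)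
    (h.extOneVanishes_of_d_eq_zero (fun _ _ => rfl) (fun n => hX.2 (n + 1)) hY)

variable [EnoughInjectives A]

/-- If `𝓣` cogenerates the pair `(𝓕, 𝓓)` and contains a separator, then the spheres and the discs
on `𝓣` cogenerate `𝓓~`: being orthogonal to the spheres on the separator forces a complex to be
acyclic, and being orthogonal to the other ones forces its cycles to be in `𝓓`. -/
lemma tilde_right_eq_rightPerp {T : ObjectProperty A} (hT : rightPerp T = D) {G : A} (hTG : T G)
    (hG : IsSeparator G) : tilde D = rightPerp (spheresAndDiscs T) := by
  have hTF : T ≤ F := by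
    rw [h.left, ← hT]
    exact le_leftPerp_rightPerp T
  have := h.left_isStableUnderRetracts
  ext Y
  refine ⟨fun hY X hX => ?_, fun hY => ?_⟩
  · obtain ⟨n, M, hM⟩ | ⟨n, M, hM⟩ := hX
    · exact h.extOneVanishes_of_d_eq_zero (fun _ _ => rfl)
        (prop_single_X h.left_of_isZero (hTF _ hM) n) hY
    · exact h.extOneVanishes_tilde (tilde_disc h.left_of_isZero n (hTF _ hM)) hY
  · have h₁ (M : A) (hM : T M) ⦃m n k : ℤ⦄ (hm : m + 1 = n) (hk : n + 1 = k) (f : M ⟶ Y.X n)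
        (hf : f ≫ Y.d n k = 0) : ∃ g, g ≫ Y.d m n = f :=
      exists_comp_d_eq_of_acyclic (homComplex_single_left_acyclic
        fun n => hY _ (.sphere n M hM)) hm hk f hf
    have h₂ : Y.Acyclic := acyclic_of_isSeparator hG (h₁ G hTG)
    refine ⟨h₂, fun n => ?_⟩
    rw [← hT]
    exact fun M hM => .cycles_right h₂ rfl _ (hY _ (.disc n M hM)).of_disc_left
      (h₁ M hM rfl rfl)

lemma dgLeft_eq_leftPerp : dgLeft F D = leftPerp (tilde D) := by
  have := h.right_isStableUnderRetracts
  ext X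
  refine ⟨fun hX Y hY => ?_, fun hX => ⟨h.left_X_of_leftPerp_tilde hX, fun Y hY => ?_⟩⟩
  · exact .of_homComplex_acyclic (fun n => h.extOneVanishes (hX.1 n) (h.tilde_right_X hY n))
      (hX.2 Y hY)
  · exact homComplex_acyclic_of_extOneVanishes_right fun n => hX _ (tilde_shift hY n)

lemma dgRight_eq_rightPerp : dgRight F D = rightPerp (tilde F) := by
  have := h.left_isStableUnderRetracts
  ext Y
  refine ⟨fun hY X hX => ?_, fun hY => ⟨fun n => (h.right_iff _).2 fun T hT => ?_,
    fun X hX => ?_⟩⟩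
  · exact .of_homComplex_acyclic (fun n => h.extOneVanishes (h.tilde_left_X hX n) (hY.1 n))
      (hY.2 X hX)
  · exact (hY _ (tilde_disc h.left_of_isZero n hT)).of_disc_left
  · exact homComplex_acyclic_of_extOneVanishes_left fun n => hY _ (tilde_shift hX n)

lemma tilde_le_dgRight : tilde D ≤ dgRight F D := by
  rw [h.dgRight_eq_rightPerp]
  exact fun Y hY X hX => h.extOneVanishes_tilde hX hY

lemma tilde_le_dgLeft : tilde F ≤ dgLeft F D := by
  rw [h.dgLeft_eq_leftPerp]
  exact fun X hX Y hY => h.extOneVanishes_tilde hX hY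

/-- The class `𝓕~` is the left orthogonal of `dg 𝓓~`: it is enough to test against the objects of
`𝓓` placed in a single degree, where those on injective objects force a complex to be acyclic. -/
lemma tilde_left_eq_leftPerp : tilde F = leftPerp (dgRight F D) := by
  refine le_antisymm (fun X hX => ?_) fun X hX => ?_
  · rw [h.dgRight_eq_rightPerp]
    exact le_leftPerp_rightPerp _ X hX
  · have h₁ (C : A) (hC : D C) ⦃m n k : ℤ⦄ (hm : m + 1 = n) (hk : n + 1 = k) (f : X.X n ⟶ C)
        (hf : X.d m n ≫ f = 0) : ∃ g, X.d n k ≫ g = f :=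
      exists_d_comp_eq_of_acyclic (homComplex_single_right_acyclic
        fun n => hX _ (h.dgRight_single hC n)) hm hk f hf
    have h₂ : X.Acyclic := acyclic_of_injective fun I _ => h₁ I (h.right_of_injective I)
    have h₃ := h.left_X_of_leftPerp_tilde (leftPerp_antitone h.tilde_le_dgRight _ hX)
    exact ⟨h₂, fun n => (h.left_iff _).2 fun C hC =>
      .cycles_left h₂ (fun n => h.extOneVanishes (h₃ n) hC) (h₁ C hC) n⟩

lemma isCotorsionPair_tilde_dgRight : IsCotorsionPair (tilde F) (dgRight F D) where
  left := h.tilde_left_eq_leftPerp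
  right := h.dgRight_eq_rightPerp

end IsCotorsionPair

end Classes

/-! ### Compatibility of the induced cotorsion pairs -/

section Compatible

open CochainComplex HomologicalComplex HomComplex ZeroObject

variable {A : Type u} [Category.{v} A] [Abelian A]

/-- The Hom complexes to the terms of a short exact sequence of complexes form a short exact
sequence if the components of the source have no extensions by those of the kernel. -/
lemma homComplex_acyclic_of_shortExact {X : CochainComplex A ℤ}
    {S : ShortComplex (CochainComplex A ℤ)} (hS : S.ShortExact)
    (h₁ : ∀ p q, ExtOneVanishes (X.X p) (S.X₁.X q)) (h₂ : (HomComplex X S.X₂).Acyclic)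
    (h₃ : (HomComplex X S.X₃).Acyclic) : (HomComplex X S.X₁).Acyclic := by
  have hS' := (HomologicalComplex.shortExact_iff_degreewise_shortExact _).1 hS
  have hw : (Cochain.ofHom S.f).comp (Cochain.ofHom S.g) (zero_add 0) = 0 := by
    rw [← Cochain.ofHom_comp, S.zero, Cochain.ofHom_zero]
  have hinj {n : ℤ} {a b : Cochain X S.X₁ n}
      (hab : a.comp (.ofHom S.f) (add_zero n) = b.comp (.ofHom S.f) (add_zero n)) : a = b := by
    ext p q hpq
    have : Mono (S.f.f q) := (hS' q).mono_f
    have := Cochain.congr_v hab p q hpq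
    rw [← cancel_mono (S.f.f q)]
    simpa using this
  have hker {n : ℤ} {b : Cochain X S.X₂ n} (hb : b.comp (.ofHom S.g) (add_zero n) = 0) :
      ∃ a : Cochain X S.X₁ n, a.comp (.ofHom S.f) (add_zero n) = b := by
    have (p q : ℤ) (hpq : p + n = q) : ∃ l, l ≫ S.f.f q = b.v p q hpq := by
      obtain ⟨l, hl⟩ := KernelFork.IsLimit.lift' (hS' q).fIsKernel (b.v p q hpq)
        (by
          have := Cochain.congr_v hb p q hpq
          rwa [Cochain.comp_zero_cochain_v, Cochain.ofHom_v, Cochain.zero_v] at this)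
      exact ⟨l, hl⟩
    choose l hl using this
    exact ⟨.mk l, by ext p q hpq; simp [hl]⟩
  have hsurj {n : ℤ} (c : Cochain X S.X₃ n) :
      ∃ b : Cochain X S.X₂ n, b.comp (.ofHom S.g) (add_zero n) = c := by
    have (p q : ℤ) (hpq : p + n = q) : ∃ l : X.X p ⟶ S.X₂.X q, l ≫ S.g.f q = c.v p q hpq :=
      (h₁ p q).exists_lift (hS' q) _
    choose l hl using this
    exact ⟨.mk l, by ext p q hpq; simp [hl]⟩
  refine (homComplex_acyclic_iff _ _).2 fun n z hz => ?_
  obtain ⟨β, hβ⟩ := (homComplex_acyclic_iff _ _).1 h₂ n (z.comp (.ofHom S.f) (add_zero n))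
    (by simp [hz])
  obtain ⟨γ, hγ⟩ := exists_δ_eq_of_acyclic h₃ (n := n - 2) (m := n - 1) (by lia)
    (Cocycle.mk (β.comp (.ofHom S.g) (add_zero _)) n (by lia)
      (by simp [hβ, Cochain.comp_assoc_of_second_is_zero_cochain, hw]))
  obtain ⟨γ', rfl⟩ := hsurj γ
  obtain ⟨α, hα⟩ := hker (b := β - δ (n - 2) (n - 1) γ') (by simpa [sub_eq_zero] using hγ.symm)
  refine ⟨α, hinj ?_⟩
  have := congrArg (δ (n - 1) n) hα
  rw [δ_sub, δ_δ, sub_zero, hβ] at this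
  simpa using this

lemma quasiIso_of_acyclic {X Y : CochainComplex A ℤ} (f : X ⟶ Y) (hX : X.Acyclic)
    (hY : Y.Acyclic) : QuasiIso f where
  quasiIsoAt n := by
    rw [quasiIsoAt_iff_isIso_homologyMap]
    exact (hX n).isZero_homology.isIso (hY n).isZero_homology _

/-- The augmented injective resolution: an object `C` of a class `L` which contains the injective
objects and is closed under cokernels of monomorphisms is the kernel of an epimorphism from a
bounded below complex of injective objects to an object of `L~`. -/
lemma exists_injective_resolution_tilde [EnoughInjectives A] {L : ObjectProperty A}
    (hI : ∀ I, Injective I → L I) (hL : ∀ ⦃S : ShortComplex A⦄, S.ShortExact → L S.X₁ → L S.X₂ →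
      L S.X₃) {C : A} (hC : L C) (h₀ : L.IsClosedUnderIsomorphisms) :
    ∃ S : ShortComplex (CochainComplex A ℤ), S.ShortExact ∧ S.X₁ = (singleFunctor A 0).obj C ∧
      S.X₂.IsKInjective ∧ tilde L S.X₃ := by
  let R := InjectiveResolution.of C
  have : Mono R.ι' := mono_of_mono_f _ fun n => by
    by_cases hn : n = 0
    · subst hn
      rw [R.ι'_f_zero]
      exact mono_comp' (inferInstanceAs (Mono (singleObjXSelf (.up ℤ) 0 C).hom))
        (mono_comp' (inferInstanceAs (Mono (R.ι.f 0))) inferInstance)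
    · exact (isZero_single_obj_X (.up ℤ) 0 C n hn).mono _
  have hS := shortExact_cokernel R.ι'
  have hac : (cokernel R.ι').Acyclic := hS.acyclic_X₃ inferInstance
  have hS' := (HomologicalComplex.shortExact_iff_degreewise_shortExact _).1 hS
  have hX (n : ℤ) : L ((cokernel R.ι').X n) := hL (hS' n)
    (prop_single_X (fun Z hZ => hI Z hZ.injective) hC 0 n)
    (hI _ (inferInstanceAs (Injective (R.cochainComplex.X n))))
  have h₁ (n : ℤ) (hn : n < 0) : L ((cokernel R.ι').cycles n) := hI _ (by
    have h₂ : IsZero ((cokernel R.ι').X n) := by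
      have := (hS' n).epi_g
      exact (CochainComplex.isZero_of_isStrictlyGE R.cochainComplex 0 n hn).of_epi
        ((cokernel.π R.ι').f n)
    exact (h₂.of_mono ((cokernel R.ι').iCycles n)).injective)
  refine ⟨_, hS, rfl, inferInstanceAs R.cochainComplex.IsKInjective, hac, fun n => ?_⟩
  obtain hn | hn := lt_or_ge n (-1)
  · exact h₁ n (by lia)
  · induction n, hn using Int.leInduction with
    | base => exact h₁ _ (by simp)
    | succ n hn ih => exact hL (shortExact_cycles hac rfl) ih (hX n)

namespace IsCotorsionPair

variable {F D : ObjectProperty A} (h : IsCotorsionPair F D)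

include h

/-- If `𝓕` contains a separator and is closed under kernels of epimorphisms, then `𝓓` is closed
under cokernels of monomorphisms. An extension of `X` in `𝓕` by such a cokernel is split by
comparing it with a presentation of `X` by a coproduct of copies of the separator, whose kernel
is in `𝓕`. -/
lemma right_cokernel [IsGrothendieckAbelian.{v} A] (hG : ∃ G : A, F G ∧ IsSeparator G)
    (hker : ∀ ⦃X Y : A⦄ (f : X ⟶ Y), Epi f → F X → F Y → F (kernel f))
    ⦃S : ShortComplex A⦄ (hS : S.ShortExact) (h₁ : D S.X₁) (h₂ : D S.X₂) : D S.X₃ := by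
  obtain ⟨G, hFG, hG⟩ := hG
  refine (h.right_iff _).2 fun X hX => .of_split fun E i p w hE => ?_
  have := hE.epi_g
  obtain ⟨I, l, hI, hl⟩ := exists_epi_coprodDesc hG p
  have hP := shortExact_kernel (coprodDesc G I)
  have hK : F (kernel (coprodDesc G I)) :=
    hker _ hI (h.left_coproduct _ fun _ => hFG) hX
  -- the morphism `k` to `S.X₃` lifts to `S.X₂`, and the lift extends to the coproduct
  obtain ⟨k, hk⟩ := KernelFork.IsLimit.lift' hE.fIsKernel (kernel.ι (coprodDesc G I) ≫ l)
    (by simp [hl])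
  obtain ⟨k', rfl⟩ := (h.extOneVanishes hK h₁).exists_lift hS k
  obtain ⟨e, rfl⟩ := (h.extOneVanishes hX h₂).exists_extension hP k'
  obtain ⟨s, hs⟩ := CokernelCofork.IsColimit.desc' hP.gIsCokernel (l - e ≫ S.g ≫ i)
    (by simpa [sub_eq_zero] using hk.symm)
  dsimp at hs
  refine ⟨s, ?_⟩
  rw [← cancel_epi (coprodDesc G I), reassoc_of% hs]
  simp [hl, w]

variable [IsGrothendieckAbelian.{v} A] (hG : ∃ G : A, F G ∧ IsSeparator G)
  (hker : ∀ ⦃X Y : A⦄ (f : X ⟶ Y), Epi f → F X → F Y → F (kernel f))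

include hG hker

/-- An acyclic complex `X` in `dg 𝓕~` has cycles in `𝓕`. For `C` in `𝓓`, let `I` be an injective
resolution of `C`; the cokernel of `C ⟶ I` is in `𝓓~` because `𝓓` is closed under cokernels of
monomorphisms. As `I` is K-injective, both `Hom(X, I)` and `Hom(X, I/C)` are exact, hence so
is `Hom(X, C)`. -/
lemma tilde_left_eq_inf : tilde F = dgLeft F D ⊓ acyclic A := by
  refine le_antisymm (fun X hX => ⟨h.tilde_le_dgLeft X hX, hX.1⟩) fun X hX => ?_
  refine ⟨hX.2, fun n => (h.left_iff _).2 fun C hC => ?_⟩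
  have := h.right_isStableUnderRetracts
  obtain ⟨S, hS, hS₁, hS₂, hS₃⟩ := exists_injective_resolution_tilde
    (fun I _ => h.right_of_injective I) (h.right_cokernel hG hker) hC inferInstance
  have hXC : (HomComplex X ((singleFunctor A 0).obj C)).Acyclic := by
    rw [← hS₁]
    refine homComplex_acyclic_of_shortExact hS (fun p q => ?_) ?_ (hX.1.2 _ hS₃)
    · rw [hS₁]
      exact h.extOneVanishes (hX.1.1 p) (prop_single_X h.right_of_isZero hC 0 q)
    · exact (homComplex_acyclic_iff _ _).2 fun n z hz =>
        IsKInjective.eq_δ_of_cocycle (Cocycle.mk z _ rfl hz) hX.2 _ (by lia)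
  exact .cycles_left hX.2 (fun n => h.extOneVanishes (hX.1.1 n) hC)
    (fun _ _ _ hm hk => exists_d_comp_eq_of_acyclic hXC hm hk) n

omit hker in
/-- The pair `(dg 𝓕~, 𝓓~)` is a complete cotorsion pair, as it is cogenerated by a set
of spheres and discs. -/
theorem isCompleteCotorsionPair_dgLeft_tilde (hD : IsCogeneratedBySet D) :
    IsCompleteCotorsionPair (dgLeft F D) (tilde D) := by
  obtain ⟨T, hT, hTD⟩ := hD
  obtain ⟨G, hFG, hG'⟩ := id hG
  have hT' : rightPerp (T ⊔ .singleton G) = D := by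
    rw [← hTD]
    refine le_antisymm (rightPerp_antitone le_sup_left) fun Y hY X hX => ?_
    obtain hX | hX := hX
    · exact hY X hX
    obtain rfl := (ObjectProperty.singleton_iff _ _).1 hX
    exact h.extOneVanishes hFG (hTD ▸ hY)
  have h' := h.tilde_right_eq_rightPerp hT' (Or.inr (by simp)) hG'
  rw [h.dgLeft_eq_leftPerp, h']
  refine isCompleteCotorsionPair_of_small _ fun M =>
    ⟨_, _, fun Y hY => .coproduct _ fun x => hY _ (.disc _ _ (Or.inr (by simp))),
      epi_desc_fromDisc hG' M⟩

/-- An acyclic complex `Y` in `dg 𝓓~` has cycles in `𝓓`: the cokernel of an embedding of `Y` in an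
object of `𝓓~`, provided by completeness of `(dg 𝓕~, 𝓓~)`, is acyclic and hence in `𝓕~`, so that
`Y` is a direct summand. -/
lemma tilde_right_eq_inf (hD : IsCogeneratedBySet D) : tilde D = dgRight F D ⊓ acyclic A := by
  refine le_antisymm (fun Y hY => ⟨h.tilde_le_dgRight Y hY, hY.1⟩) fun Y hY => ?_
  have hc := h.isCompleteCotorsionPair_dgLeft_tilde hG hD
  have := hc.right_isStableUnderRetracts
  obtain ⟨Q, P, i, q, w, hS, hQ, hP⟩ := hc.exists_right Y
  have hP' : tilde F P := by
    rw [h.tilde_left_eq_inf hG hker]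
    exact ⟨hP, hS.acyclic_X₃ (quasiIso_of_acyclic i hY.2 hQ.1)⟩
  obtain ⟨r, hr⟩ := (h.isCotorsionPair_tilde_dgRight.extOneVanishes hP' hY.1).exists_retraction hS
  exact (tilde D).prop_of_retract ⟨i, r, hr⟩ hQ

end IsCotorsionPair

end Compatible

/-! ### Left resolutions by objects of a small class -/

section TestObjects

open ZeroObject

variable {A : Type u} [Category.{v} A] [Abelian A] [IsGrothendieckAbelian.{v} A] (G : A)

/-- The stages of the construction of a set of objects of `A` that contains the quotients of `G`
and is closed under taking suitable one step resolutions. -/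
def testObjectsStage : ℕ → ObjectProperty A
  | 0 => .pair 0 G ⊔ .ofObj fun U : Subobject G => cokernel U.arrow
  | n + 1 => .ofObj (fun x : Σ W : Subtype (testObjectsStage n), Set (G ⟶ W.1) =>
        ∐ fun _ : x.2 => G) ⊔
      .ofObj (fun x : Σ W : Subtype (testObjectsStage n), Set (G ⟶ W.1) =>
        kernel (coprodDesc G x.2))

/-- A set of objects of `A` that contains the quotients of `G` and is closed under taking the
coproducts `P` of copies of `G` indexed by sets of morphisms from `G` to one of its objects `W`,
and under taking the kernels of the canonical morphisms `P ⟶ W`. -/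
def testObjects : ObjectProperty A := ⨆ n, testObjectsStage G n

instance (n : ℕ) : ObjectProperty.Small.{v} (testObjectsStage G n) := by
  induction n with
  | zero => dsimp only [testObjectsStage]; infer_instance
  | succ n ih =>
    have : Small.{v} (Subtype (testObjectsStage G n)) := ih
    dsimp only [testObjectsStage]
    infer_instance

instance : ObjectProperty.Small.{v} (testObjects G) := by
  dsimp only [testObjects]
  infer_instance

variable {G}

lemma testObjectsStage_le (n : ℕ) : testObjectsStage G n ≤ testObjects G :=
  le_iSup (testObjectsStage G) n

lemma testObjects_zero : testObjects G 0 :=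
  testObjectsStage_le 0 _ (Or.inl (by simp))

lemma testObjects_self : testObjects G G :=
  testObjectsStage_le 0 _ (Or.inl (by simp))

lemma testObjects_cokernel (U : Subobject G) : testObjects G (cokernel U.arrow) :=
  testObjectsStage_le 0 _ (Or.inr (ObjectProperty.ofObj_apply _ U))

lemma testObjects_coproduct {W : A} (hW : testObjects G W) (I : Set (G ⟶ W)) :
    testObjects G (∐ fun _ : I => G) ∧ testObjects G (kernel (coprodDesc G I)) := by
  obtain ⟨n, hW⟩ : ∃ n, testObjectsStage G n W := by simpa [testObjects] using hW
  let x : Σ W : Subtype (testObjectsStage G n), Set (G ⟶ W.1) := ⟨⟨W, hW⟩, I⟩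
  exact ⟨testObjectsStage_le (n + 1) _ (Or.inl (ObjectProperty.ofObj_apply _ x)),
    testObjectsStage_le (n + 1) _ (Or.inr (ObjectProperty.ofObj_apply _ x))⟩

/-- If `q` is an epimorphism to an object `W` of `testObjects G`, then there is an epimorphism
from an object `P` to `W` which factors through `q`, where `P` and the kernel
are in `testObjects G`. -/
lemma exists_epi_testObjects (hG : IsSeparator G) {Z W : A} (q : Z ⟶ W) [Epi q]
    (hW : testObjects G W) : ∃ (P : A) (p : P ⟶ W) (l : P ⟶ Z), Epi p ∧ l ≫ q = p ∧
      testObjects G P ∧ testObjects G (kernel p) := by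
  obtain ⟨I, l, hI, hl⟩ := exists_epi_coprodDesc hG q
  exact ⟨_, coprodDesc G I, l, hI, hl, testObjects_coproduct hW I⟩

end TestObjects

/-! ### Cogenerating the dg-injective complexes by a set -/

section DGInjective

open CochainComplex HomologicalComplex HomComplex ZeroObject

variable {A : Type u} [Category.{v} A] [Abelian A]

/-- The acyclic complexes with components in `W`. -/
def acyclicWithComponentsIn (W : ObjectProperty A) : ObjectProperty (CochainComplex A ℤ) :=
  fun X => X.Acyclic ∧ ∀ n, W (X.X n)

instance (W : ObjectProperty A) [ObjectProperty.Small.{v} W] :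
    ObjectProperty.Small.{v} (acyclicWithComponentsIn W) := by
  have : Small.{v} (Subtype W) := inferInstanceAs (ObjectProperty.Small.{v} W)
  refine small_of_injective (β := Σ X : ℤ → Subtype W, ∀ i j, (X i).1 ⟶ (X j).1)
    (f := fun S => ⟨fun n => ⟨S.1.X n, S.2.2 n⟩, fun i j => S.1.d i j⟩) ?_
  rintro ⟨⟨X, d, _, _⟩, hS⟩ ⟨⟨X', d', _, _⟩, hS'⟩ h
  obtain ⟨h₁, h₂⟩ := Sigma.mk.inj h
  obtain rfl : X = X' := funext fun n => congrArg Subtype.val (congrFun h₁ n)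
  obtain rfl : d = d' := eq_of_heq h₂
  rfl

/-- The components of the complex `splice`. -/
noncomputable def spliceX (K P : ℕ → A) : ℤ → A
  | .ofNat 0 => K 0
  | .ofNat (_ + 1) => 0
  | .negSucc k => P k

/-- The differential of the complex `splice`. -/
noncomputable def spliceD {K P : ℕ → A} (i : ∀ k, K (k + 1) ⟶ P k) (p : ∀ k, P k ⟶ K k) :
    ∀ n, spliceX K P n ⟶ spliceX K P (n + 1)
  | .ofNat _ => 0
  | .negSucc 0 => p 0
  | .negSucc (k + 1) => p (k + 1) ≫ i k

/-- The complex `⋯ → P 1 → P 0 → K 0 → 0 → ⋯`, with `K 0` in degree `0`, obtained by splicing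
the complexes `K (k + 1) → P k → K k`. -/
noncomputable def splice {K P : ℕ → A} (i : ∀ k, K (k + 1) ⟶ P k) (p : ∀ k, P k ⟶ K k)
    (w : ∀ k, i k ≫ p k = 0) : CochainComplex A ℤ :=
  CochainComplex.of (spliceX K P) (spliceD i p) fun
    | .ofNat _ => zero_comp
    | .negSucc 0 => comp_zero
    | .negSucc 1 => by
      change (p 1 ≫ i 0) ≫ p 0 = 0
      rw [Category.assoc, w, comp_zero]
    | .negSucc (k + 2) => by
      change (p (k + 2) ≫ i (k + 1)) ≫ p (k + 1) ≫ i k = 0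
      rw [Category.assoc, reassoc_of% (w (k + 1)), zero_comp, comp_zero]

section

variable {K P : ℕ → A} {i : ∀ k, K (k + 1) ⟶ P k} {p : ∀ k, P k ⟶ K k} {w : ∀ k, i k ≫ p k = 0}

lemma splice_d (n : ℤ) : (splice i p w).d n (n + 1) = spliceD i p n :=
  CochainComplex.of_d _ _ n

lemma splice_d_zero : (splice i p w).d (.negSucc 0) 0 = p 0 :=
  splice_d (.negSucc 0)

lemma splice_d_succ (k : ℕ) :
    (splice i p w).d (.negSucc (k + 1)) (.negSucc k) = p (k + 1) ≫ i k :=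
  splice_d (.negSucc (k + 1))

lemma exact_epi_comp_comp_mono {S : ShortComplex A} (hS : S.Exact) {X Y : A} (e : X ⟶ S.X₁) [Epi e]
    (m : S.X₃ ⟶ Y) [Mono m] {f : X ⟶ S.X₂} {g : S.X₂ ⟶ Y} (hf : f = e ≫ S.f) (hg : g = S.g ≫ m)
    (w : f ≫ g = 0) : (ShortComplex.mk f g w).Exact := by
  subst hf hg
  let φ : ShortComplex.mk (e ≫ S.f) S.g (by simp) ⟶ S := { τ₁ := e, τ₂ := 𝟙 _, τ₃ := 𝟙 _ }
  let ψ : ShortComplex.mk (e ≫ S.f) S.g (by simp) ⟶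
    ShortComplex.mk (e ≫ S.f) (S.g ≫ m) (by simp) := { τ₁ := 𝟙 _, τ₂ := 𝟙 _, τ₃ := m }
  rwa [← ShortComplex.exact_iff_of_epi_of_isIso_of_mono ψ,
    ShortComplex.exact_iff_of_epi_of_isIso_of_mono φ]

lemma splice_acyclic (h : ∀ k, (ShortComplex.mk (i k) (p k) (w k)).ShortExact) :
    (splice i p w).Acyclic := fun n => by
  have hp (k : ℕ) : Epi (p k) := (h k).epi_g
  have (k : ℕ) : Mono (i k) := (h k).mono_f
  match n with
  | .ofNat 0 =>
    refine ((splice i p w).exactAt_iff' (.negSucc 0) (.ofNat 0) (.ofNat 1) (by simp)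
      (by simp)).2 ((ShortComplex.exact_iff_epi _ (splice_d (w := w) (.ofNat 0))).2 ?_)
    change Epi ((splice i p w).d (.negSucc 0) 0)
    rw [splice_d_zero]
    exact hp 0
  | .ofNat (k + 1) => exact ShortComplex.exact_of_isZero_X₂ _ (isZero_zero A)
  | .negSucc 0 =>
    refine ((splice i p w).exactAt_iff' (.negSucc 1) (.negSucc 0) (.ofNat 0) (by simp)
      (by simp)).2 ?_
    exact exact_epi_comp_comp_mono (h 0).exact (p 1) (𝟙 (K 0)) (splice_d_succ (w := w) 0)
      ((splice_d_zero (w := w)).trans (Category.comp_id _).symm) _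
  | .negSucc (k + 1) =>
    refine ((splice i p w).exactAt_iff' (.negSucc (k + 2)) (.negSucc (k + 1)) (.negSucc k)
      (by simp) (by simp; rfl)).2 ?_
    exact exact_epi_comp_comp_mono (h (k + 1)).exact (p (k + 2)) (i k)
      (splice_d_succ (w := w) (k + 1)) (splice_d_succ (w := w) k) _

/-- A morphism from a spliced complex. -/
noncomputable def spliceDesc {Q : CochainComplex A ℤ} (f : K 0 ⟶ Q.X 0) (hf : f ≫ Q.d 0 1 = 0)
    (φ : ∀ k, P k ⟶ Q.X (.negSucc k)) (h₀ : φ 0 ≫ Q.d (.negSucc 0) 0 = p 0 ≫ f)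
    (hφ : ∀ k, φ (k + 1) ≫ Q.d (.negSucc (k + 1)) (.negSucc k) = p (k + 1) ≫ i k ≫ φ k) :
    splice i p w ⟶ Q where
  f n := match n with
    | .ofNat 0 => f
    | .ofNat (_ + 1) => 0
    | .negSucc k => φ k
  comm' := by
    rintro n _ rfl
    match n with
    | .ofNat 0 => exact hf.trans comp_zero.symm
    | .ofNat (k + 1) => exact (isZero_zero A).eq_of_src _ _
    | .negSucc 0 => exact h₀.trans (splice_d_zero =≫ f).symm
    | .negSucc (k + 1) =>
      exact ((hφ k).trans (Category.assoc _ _ _).symm).trans (splice_d_succ k =≫ φ k).symm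

end

/-- The step of the construction of a left resolution over an acyclic complex `Q`: `P` covers the
pullback of `K` to the component of `Q` in the preceding degree. -/
lemma exists_epi_lift {G : A} [IsGrothendieckAbelian.{v} A] (hG : IsSeparator G)
    {Q : CochainComplex A ℤ} (hQ : Q.Acyclic) {l m n : ℤ} (hl : l + 1 = m) (hm : m + 1 = n)
    {K : A} (hK : testObjects G K) (κ : K ⟶ Q.X m) (hκ : κ ≫ Q.d m n = 0) :
    ∃ (P : A) (p : P ⟶ K) (φ : P ⟶ Q.X l), Epi p ∧ φ ≫ Q.d l m = p ≫ κ ∧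
      testObjects G P ∧ testObjects G (kernel p) := by
  have : Epi (Q.toCycles l m) := (exactAt_iff_epi_toCycles Q hl).1 (hQ m)
  let κ' : K ⟶ Q.cycles m := Q.liftCycles κ n (by simp [← hm]) hκ
  obtain ⟨P, p, φ, hp, hφ, hP, hk⟩ :=
    exists_epi_testObjects hG (pullback.snd (Q.toCycles l m) κ') hK
  refine ⟨P, p, φ ≫ pullback.fst _ _, hp, ?_, hP, hk⟩
  rw [← Q.toCycles_i, Category.assoc, pullback.condition_assoc, ← hφ]
  simp [κ']

lemma disc_acyclicWithComponentsIn {W : ObjectProperty A} (h₀ : W 0) {M : A} (hM : W M) (n : ℤ) :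
    acyclicWithComponentsIn W (disc n M) := by
  refine ⟨(tilde_disc (L := ⊤) (fun _ _ => trivial) n trivial).1, fun k => ?_⟩
  dsimp [disc, double]
  split_ifs <;> assumption

/-- A stage of the construction of a left resolution: an object of `W` with a morphism to the cycles
of `Q` in degree `-k`. -/
structure ResolutionStage (W : ObjectProperty A) (Q : CochainComplex A ℤ) (k : ℕ) where
  /-- the object to be resolved -/
  K : A
  hK : W K
  /-- the morphism to the component of `Q` -/
  κ : K ⟶ Q.X (-(k : ℤ))
  hκ : κ ≫ Q.d (-(k : ℤ)) (-(k : ℤ) + 1) = 0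

variable [IsGrothendieckAbelian.{v} A]

/-- An object `T` of `testObjects G` with a morphism `f` to the component in degree `0` of an
acyclic complex `Q`, with `f ≫ d = 0`, has a left resolution by objects of `testObjects G`
to which `f` extends. -/
lemma exists_left_resolution {G : A} (hG : IsSeparator G) {Q : CochainComplex A ℤ}
    (hQ : Q.Acyclic) {T : A} (hT : testObjects G T) (f : T ⟶ Q.X 0) (hf : f ≫ Q.d 0 1 = 0) :
    ∃ (S : CochainComplex A ℤ) (φ : S ⟶ Q) (e : T ⟶ S.X 0),
      acyclicWithComponentsIn (testObjects G) S ∧ IsZero (S.X 1) ∧ e ≫ φ.f 0 = f := by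
  have (k : ℕ) (x : ResolutionStage (testObjects G) Q k) :=
    exists_epi_lift hG hQ (l := .negSucc k) (by lia) rfl x.hK x.κ x.hκ
  choose P p φ hp hφ hP hK using this
  let next (k : ℕ) (x : ResolutionStage (testObjects G) Q k) :
      ResolutionStage (testObjects G) Q (k + 1) :=
    { K := kernel (p k x)
      hK := hK k x
      κ := kernel.ι (p k x) ≫ φ k x
      hκ := by
        have : Int.negSucc k + 1 = -(k : ℤ) := by lia
        change (_ ≫ _) ≫ Q.d (.negSucc k) (.negSucc k + 1) = 0
        rw [this, Category.assoc, hφ, kernel.condition_assoc, zero_comp] }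
  let st (k : ℕ) : ResolutionStage (testObjects G) Q k :=
    Nat.rec { K := T, hK := hT, κ := f, hκ := hf } next k
  have w (k : ℕ) : kernel.ι (p k (st k)) ≫ p k (st k) = 0 := kernel.condition _
  refine ⟨splice (K := fun k => (st k).K) (P := fun k => P k (st k))
      (fun k => kernel.ι (p k (st k))) (fun k => p k (st k)) w,
    spliceDesc f hf (fun k => φ k (st k)) (hφ 0 (st 0)) (fun k => hφ (k + 1) (st (k + 1))), 𝟙 T,
    ⟨splice_acyclic fun k => ?_, fun n => ?_⟩, isZero_zero A, Category.id_comp _⟩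
  · have := hp k (st k)
    exact shortExact_kernel _
  · match n with
    | .ofNat 0 => exact hT
    | .ofNat (k + 1) => exact testObjects_zero
    | .negSucc k => exact hP k (st k)

/-- Baer's criterion, with a separator in the place of the ring. -/
lemma injective_of_extOneVanishes_quotients {G : A} (hG : IsSeparator G) {Z : A}
    (h : ∀ U : Subobject G, ExtOneVanishes (cokernel U.arrow) Z) : Injective Z where
  factors {X Y} g f _ := by
    have : (IsGrothendieckAbelian.generatingMonomorphisms G).rlp (0 : Z ⟶ 0) := by
      rintro _ _ _ ⟨U⟩
      refine ⟨fun {t b} sq => ?_⟩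
      obtain ⟨l, hl⟩ := (h U).exists_extension (shortExact_cokernel U.arrow) t
      exact ⟨⟨⟨l, hl, (isZero_zero A).eq_of_tgt _ _⟩⟩⟩
    rw [IsGrothendieckAbelian.generatingMonomorphisms_rlp hG] at this
    have := this f (.infer_property _)
    have sq : CommSq g f (0 : Z ⟶ 0) 0 := ⟨(isZero_zero A).eq_of_tgt _ _⟩
    exact ⟨sq.lift, sq.fac_left⟩

/-- The acyclic complexes that are right orthogonal to the acyclic complexes with components
in `testObjects G` have injective cycles. By Baer's criterion it suffices to lift morphisms from a
quotient `T` of the separator to the cycles; a left resolution of `T` maps to `Q`, and a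
null-homotopy of this morphism is a lift. -/
lemma injective_cycles {G : A} (hG : IsSeparator G) {Q : CochainComplex A ℤ} (hQ : Q.Acyclic)
    (hQ' : rightPerp (acyclicWithComponentsIn (testObjects G)) Q) (n : ℤ) :
    Injective (Q.cycles n) := by
  let R := Q⟦n + 1⟧
  have e : R.cycles (-1) ≅ Q.cycles n := ShortComplex.cyclesMapIso
    ((shiftShortComplexFunctorIso A (n + 1) (-1) n (by lia)).app Q)
  refine Injective.of_iso e (injective_of_extOneVanishes_quotients hG fun U => ?_)
  have hR : R.Acyclic := acyclic_shift hQ _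
  refine .cycles_right hR (neg_add_cancel 1) 1 (hQ' _ (disc_acyclicWithComponentsIn
    testObjects_zero (testObjects_cokernel U) _)).of_disc_left fun f hf => ?_
  obtain ⟨S, φ, e, hS, hS₁, rfl⟩ := exists_left_resolution hG hR (testObjects_cokernel U) f hf
  have hSQ : (HomComplex S Q).Acyclic := homComplex_acyclic_of_extOneVanishes_left fun n =>
    hQ' _ ⟨acyclic_shift hS.1 n, fun i => hS.2 (i + n)⟩
  obtain ⟨H⟩ := homotopy_of_acyclic (homComplex_acyclic_shift hSQ (n + 1)) φ
  refine ⟨e ≫ H.hom 0 (-1), ?_⟩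
  have := H.comm 0
  rw [dNext_eq H.hom (show (ComplexShape.up ℤ).Rel 0 1 from rfl),
    prevD_eq H.hom (show (ComplexShape.up ℤ).Rel (-1) 0 from rfl),
    hS₁.eq_of_src (H.hom 1 0) 0] at this
  rw [this, comp_zero, zero_add, zero_f, add_zero, Category.assoc]

variable (A) in
/-- The cotorsion pair formed by all objects and the injective objects. -/
lemma isCotorsionPair_injective :
    IsCotorsionPair (⊤ : ObjectProperty A) (fun I : A => Injective I) where
  left := (eq_top_iff.2 fun X _ Y (_ : Injective Y) => .of_injective X Y).symm
  right := by
    ext Y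
    refine ⟨fun (_ : Injective Y) X _ => .of_injective X Y, fun h => ?_⟩
    exact injective_of_extOneVanishes_quotients (isSeparator_separator A) fun U => h _ trivial

variable (A) in
/-- The acyclic complexes form a complete cotorsion pair with their right orthogonal, the class of
dg-injective complexes. The set of acyclic complexes with components in `testObjects G` cogenerates
a complete cotorsion pair; its left class consists of acyclic complexes, and it contains all of them
because an acyclic complex is a direct summand of its approximation, whose kernel has injective
cycles. -/
theorem isCompleteCotorsionPair_acyclic :
    IsCompleteCotorsionPair (acyclic A) (rightPerp (acyclic A)) := by
  have hG := isSeparator_separator A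
  have h := isCotorsionPair_injective A
  have htop : tilde (⊤ : ObjectProperty A) = acyclic A := by
    ext X
    exact ⟨fun hX => hX.1, fun hX => ⟨hX, fun _ => trivial⟩⟩
  let T := acyclicWithComponentsIn (testObjects (separator A))
  have hT : T ≤ acyclic A := fun X hX => hX.1
  have hc : IsCompleteCotorsionPair (leftPerp (rightPerp T)) (rightPerp T) :=
    isCompleteCotorsionPair_of_small _ fun M =>
      ⟨_, _, fun Y hY => .coproduct _ fun x =>
        hY _ (disc_acyclicWithComponentsIn testObjects_zero testObjects_self x.1),
        epi_desc_fromDisc hG M⟩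
  have h₁ : leftPerp (rightPerp T) ≤ acyclic A := by
    rw [← htop, h.tilde_left_eq_leftPerp, h.dgRight_eq_rightPerp, htop]
    exact leftPerp_antitone (rightPerp_antitone hT)
  have h₂ : acyclic A ≤ leftPerp (rightPerp T) := fun X hX => by
    obtain ⟨Q, P, i, p, w, hS, hQ, hP⟩ := hc.exists_left X
    have hQ₁ : Q.Acyclic := hS.acyclic_X₁ (quasiIso_of_acyclic p (h₁ _ hP) hX)
    have hQ₂ : tilde (fun I : A => Injective I) Q := ⟨hQ₁, injective_cycles hG hQ₁ hQ⟩
    obtain ⟨s, hs⟩ := (h.extOneVanishes_tilde (htop ▸ hX) hQ₂).exists_section hS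
    exact ObjectProperty.prop_of_retract _ ⟨s, p, hs⟩ hP
  have h₃ : leftPerp (rightPerp T) = acyclic A := le_antisymm h₁ h₂
  have h₄ : rightPerp T = rightPerp (acyclic A) := by
    conv_lhs => rw [hc.right, h₃]
  rwa [h₃, h₄] at hc

end DGInjective

/-! ### Completeness of the second induced cotorsion pair -/

namespace IsCotorsionPair

variable {A : Type u} [Category.{v} A] [Abelian A] [IsGrothendieckAbelian.{v} A]
  {F D : ObjectProperty A}

/-- The pair `(𝓕~, dg 𝓓~)` is complete: a complex `M` embeds in a dg-injective complex `I` with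
acyclic cokernel `N`, and pulling back `I` along an approximation of `N` by `𝓕~` gives the
required embedding of `M`. -/
theorem isCompleteCotorsionPair_tilde_dgRight (h : IsCotorsionPair F D)
    (hG : ∃ G : A, F G ∧ IsSeparator G)
    (hker : ∀ ⦃X Y : A⦄ (f : X ⟶ Y), Epi f → F X → F Y → F (kernel f))
    (hD : IsCogeneratedBySet D) : IsCompleteCotorsionPair (tilde F) (dgRight F D) := by
  have := h.left_isStableUnderRetracts
  refine h.isCotorsionPair_tilde_dgRight.isComplete (fun M => ?_) fun M => ?_
  · obtain ⟨G, hFG, hG⟩ := hG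
    exact ⟨_, _, h.isCotorsionPair_tilde_dgRight.left_coproduct _ fun (x : Σ n : ℤ, (G ⟶ M.X n)) =>
      tilde_disc h.left_of_isZero x.1 hFG, epi_desc_fromDisc hG M⟩
  · obtain ⟨I, N, i, q, w, hS, hI, hN⟩ := (isCompleteCotorsionPair_acyclic A).exists_right M
    obtain ⟨B, P, j, p, w', hS', hB, hP⟩ :=
      (h.isCompleteCotorsionPair_dgLeft_tilde hG hD).exists_left N
    have hP' : tilde F P := by
      rw [h.tilde_left_eq_inf hG hker]
      exact ⟨hP, hS'.acyclic_X₂ hB.1 hN⟩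
    have sq := IsPullback.of_hasPullback q p
    obtain ⟨a, ha, -, hS₁⟩ := shortExact_of_isPullback hS sq
    obtain ⟨b, hb, -, hS₂⟩ := shortExact_of_isPullback hS' sq.flip
    refine ⟨_, _, _, _, _, hS₁, ?_, hP'⟩
    refine h.isCotorsionPair_tilde_dgRight.right_ext hS₂ (h.tilde_le_dgRight _ hB) ?_
    rw [h.dgRight_eq_rightPerp]
    exact fun X hX => hI X hX.1

end IsCotorsionPair

/-! ### The weak factorization system of a complete cotorsion pair -/

section

variable {A : Type u} [Category.{v} A] [Abelian A]

lemma monoWithCokernelIn_of_shortExact {P : ObjectProperty A} [P.IsClosedUnderIsomorphisms]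
    {S : ShortComplex A} (hS : S.ShortExact) (h : P S.X₃) : monoWithCokernelIn P S.f :=
  ⟨hS.mono_f, P.prop_of_iso
    (hS.gIsCokernel.coconePointUniqueUpToIso (colimit.isColimit _)) h⟩

lemma epiWithKernelIn_of_shortExact {P : ObjectProperty A} [P.IsClosedUnderIsomorphisms]
    {S : ShortComplex A} (hS : S.ShortExact) (h : P S.X₁) : epiWithKernelIn P S.g :=
  ⟨hS.epi_g, P.prop_of_iso
    (hS.fIsKernel.conePointUniqueUpToIso (limit.isLimit _)) h⟩

lemma monoWithCokernelIn_iff_of_isZero {P : ObjectProperty A} [P.IsClosedUnderIsomorphisms]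
    {Z X : A} (f : Z ⟶ X) (hZ : IsZero Z) : monoWithCokernelIn P f ↔ P X := by
  obtain rfl : f = 0 := hZ.eq_of_src _ _
  have e : cokernel (0 : Z ⟶ X) ≅ X := cokernelZeroIsoTarget
  exact ⟨fun h => P.prop_of_iso e h.2,
    fun h => ⟨⟨fun _ _ _ => hZ.eq_of_tgt _ _⟩, P.prop_of_iso e.symm h⟩⟩

lemma epiWithKernelIn_iff_of_isZero {P : ObjectProperty A} [P.IsClosedUnderIsomorphisms]
    {X Z : A} (f : X ⟶ Z) (hZ : IsZero Z) : epiWithKernelIn P f ↔ P X := by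
  obtain rfl : f = 0 := hZ.eq_of_tgt _ _
  have e : kernel (0 : X ⟶ Z) ≅ X := kernelZeroIsoSource
  exact ⟨fun h => P.prop_of_iso e h.2,
    fun h => ⟨⟨fun _ _ _ => hZ.eq_of_src _ _⟩, P.prop_of_iso e.symm h⟩⟩

instance (P : ObjectProperty A) [P.IsStableUnderRetracts] :
    (monoWithCokernelIn P).IsStableUnderRetracts where
  of_retract {X Y Z W f g} h hg := by
    refine ⟨(MorphismProperty.monomorphisms A).of_retract h hg.1, P.prop_of_retract
      ⟨cokernel.map f g h.i.left h.i.right h.i_w.symm,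
        cokernel.map g f h.r.left h.r.right h.r_w.symm, ?_⟩ hg.2⟩
    ext
    simp

instance (P : ObjectProperty A) [P.IsStableUnderRetracts] :
    (epiWithKernelIn P).IsStableUnderRetracts where
  of_retract {X Y Z W f g} h hg := by
    refine ⟨(MorphismProperty.epimorphisms A).of_retract h hg.1, P.prop_of_retract
      ⟨kernel.map f g h.i.left h.i.right h.i_w.symm,
        kernel.map g f h.r.left h.r.right h.r_w.symm, ?_⟩ hg.2⟩
    ext
    simp

/-- Every morphism `f : X ⟶ Y` factors as a monomorphism with cokernel in the left class followed
by an epimorphism with kernel in the right class: make `f` an epimorphism by adding to `X` an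
approximation `P ⟶ Y` of `Y` by the left class, then enlarge the kernel of `X ⊞ P ⟶ Y` to an object
of the right class. -/
lemma IsCompleteCotorsionPair.hasFactorization {F D : ObjectProperty A}
    (h : IsCompleteCotorsionPair F D) :
    (monoWithCokernelIn F).HasFactorization (epiWithKernelIn D) where
  nonempty_mapFactorizationData {X Y} f := by
    have := h.toIsCotorsionPair.left_isStableUnderRetracts
    have := h.toIsCotorsionPair.right_isStableUnderRetracts
    obtain ⟨_, P, _, p, _, hp, -, hP⟩ := h.exists_left Y
    have : Epi p := hp.epi_g
    have : Epi (biprod.desc f p) := epi_of_epi_fac (biprod.inr_desc f p)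
    obtain ⟨Q, N, j, q, w, hS, hQ, hN⟩ := h.exists_right (kernel (biprod.desc f p))
    have sq := IsPushout.of_hasPushout (kernel.ι (biprod.desc f p)) j
    obtain ⟨r, hr, hr', hS₁⟩ := shortExact_of_isPushout (shortExact_kernel _) sq
    obtain ⟨s, hs, hs', hS₂⟩ := shortExact_of_isPushout hS sq.flip
    -- the cokernel of `X ⟶ X ⊞ P ⟶ E` is an extension of `N` by `P`
    have sq' := IsPushout.of_hasPushout (pushout.inl (kernel.ι (biprod.desc f p)) j)
      (biprod.snd : X ⊞ P ⟶ P)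
    obtain ⟨t, ht, ht', hS₃⟩ := shortExact_of_isPushout hS₂ sq'
    have hF := h.toIsCotorsionPair.left_ext hS₃ hP hN
    have : Mono (pushout.inl (kernel.ι (biprod.desc f p)) j) := hS₂.mono_f
    have hw : (biprod.inl ≫ pushout.inl (kernel.ι (biprod.desc f p)) j) ≫
        pushout.inl (pushout.inl (kernel.ι (biprod.desc f p)) j) (biprod.snd : X ⊞ P ⟶ P) = 0 := by
      rw [Category.assoc, pushout.condition, biprod.inl_snd_assoc, zero_comp]
    have hS₄ : (ShortComplex.mk _ _ hw).ShortExact :=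
      { exact := ShortComplex.exact_of_g_is_cokernel _
          (CokernelCofork.IsColimit.ofπ' _ _ fun {T} k hk => by
            have hk' : pushout.inl (kernel.ι (biprod.desc f p)) j ≫ k =
                biprod.snd ≫ biprod.inr ≫ pushout.inl (kernel.ι (biprod.desc f p)) j ≫ k := by
              ext
              · simpa using hk
              · simp
            exact ⟨pushout.desc k _ hk', pushout.inl_desc _ _ _⟩)
        mono_f := mono_comp _ _
        epi_g := inferInstanceAs (Epi (pushout.inl _ _)) }
    exact ⟨{
      Z := _
      i := biprod.inl ≫ pushout.inl _ _
      p := r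
      fac := by simp [hr']
      hi := monoWithCokernelIn_of_shortExact hS₄ hF
      hp := epiWithKernelIn_of_shortExact hS₁ hQ }⟩

lemma IsCompleteCotorsionPair.isWeakFactorizationSystem {F D : ObjectProperty A}
    (h : IsCompleteCotorsionPair F D) :
    MorphismProperty.IsWeakFactorizationSystem (monoWithCokernelIn F) (epiWithKernelIn D) := by
  have := h.toIsCotorsionPair.left_isStableUnderRetracts
  have := h.toIsCotorsionPair.right_isStableUnderRetracts
  have := h.hasFactorization
  refine .mk' _ _ fun i p hi hp => ?_
  have := hi.1
  have := hp.1
  exact (h.toIsCotorsionPair.extOneVanishes hi.2 hp.2).hasLiftingProperty i p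

end

/-! ### The abelian model structure of two compatible cotorsion pairs -/

section

variable {A : Type u} [Category.{v} A] [Abelian A]

lemma quasiIso_f_iff_acyclic {S : ShortComplex (CochainComplex A ℤ)} (hS : S.ShortExact) :
    QuasiIso S.f ↔ S.X₃.Acyclic := by
  refine ⟨hS.acyclic_X₃, fun h => ⟨fun n => ?_⟩⟩
  rw [quasiIsoAt_iff_isIso_homologyMap]
  have := (hS.homology_exact₁ (n - 1) n (by simp)).mono_g
    ((h (n - 1)).isZero_homology.eq_of_src _ _)
  have := (hS.homology_exact₂ n).epi_f ((h n).isZero_homology.eq_of_tgt _ _)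
  exact isIso_of_mono_of_epi _

lemma quasiIso_g_iff_acyclic {S : ShortComplex (CochainComplex A ℤ)} (hS : S.ShortExact) :
    QuasiIso S.g ↔ S.X₁.Acyclic := by
  refine ⟨hS.acyclic_X₁, fun h => ⟨fun n => ?_⟩⟩
  rw [quasiIsoAt_iff_isIso_homologyMap]
  have := (hS.homology_exact₂ n).mono_g ((h n).isZero_homology.eq_of_src _ _)
  have := (hS.homology_exact₃ n (n + 1) (by simp)).epi_f
    ((h (n + 1)).isZero_homology.eq_of_tgt _ _)
  exact isIso_of_mono_of_epi _

lemma monoWithCokernelIn_inf_quasiIso (P : ObjectProperty (CochainComplex A ℤ)) :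
    monoWithCokernelIn P ⊓ HomologicalComplex.quasiIso A (.up ℤ) =
      monoWithCokernelIn (P ⊓ acyclic A) := by
  ext X Y f
  constructor
  · rintro ⟨⟨_, h⟩, hf⟩
    exact ⟨inferInstance, h, (quasiIso_f_iff_acyclic (shortExact_cokernel f)).1 hf⟩
  · rintro ⟨_, h, hf⟩
    exact ⟨⟨inferInstance, h⟩, (quasiIso_f_iff_acyclic (shortExact_cokernel f)).2 hf⟩

lemma epiWithKernelIn_inf_quasiIso (P : ObjectProperty (CochainComplex A ℤ)) :
    epiWithKernelIn P ⊓ HomologicalComplex.quasiIso A (.up ℤ) =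
      epiWithKernelIn (P ⊓ acyclic A) := by
  ext X Y f
  constructor
  · rintro ⟨⟨_, h⟩, hf⟩
    exact ⟨inferInstance, h, (quasiIso_g_iff_acyclic (shortExact_kernel f)).1 hf⟩
  · rintro ⟨_, h, hf⟩
    exact ⟨⟨inferInstance, h⟩, (quasiIso_g_iff_acyclic (shortExact_kernel f)).2 hf⟩

/-- A model structure whose cofibrations and trivial cofibrations are the monomorphisms with
cokernel in given classes, and dually for fibrations, is abelian: the classes are recovered from
the morphisms out of, or into, the zero object. -/
lemma isAbelianModelStructure_of_eq [ModelCategory A] {P P' Q' Q : ObjectProperty A}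
    [P.IsClosedUnderIsomorphisms] [P'.IsClosedUnderIsomorphisms]
    [Q'.IsClosedUnderIsomorphisms] [Q.IsClosedUnderIsomorphisms]
    (h₁ : cofibrations A = monoWithCokernelIn P)
    (h₂ : trivialCofibrations A = monoWithCokernelIn Q')
    (h₃ : fibrations A = epiWithKernelIn Q)
    (h₄ : trivialFibrations A = epiWithKernelIn P') : IsAbelianModelStructure A where
  cofibrations_eq := by
    rw [h₁]
    congr 1
    ext X
    rw [← monoWithCokernelIn_iff_of_isZero (P := P) (initial.to X) initialIsInitial.isZero, ← h₁,
      ← cofibration_iff]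
  trivialCofibrations_eq := by
    rw [h₂]
    congr 1
    ext X
    rw [← monoWithCokernelIn_iff_of_isZero (P := Q') (initial.to X) initialIsInitial.isZero, ← h₂,
      mem_trivialCofibrations_iff]
  fibrations_eq := by
    rw [h₃]
    congr 1
    ext X
    rw [← epiWithKernelIn_iff_of_isZero (P := Q) (terminal.from X) terminalIsTerminal.isZero, ← h₃,
      ← fibration_iff]
  trivialFibrations_eq := by
    rw [h₄]
    congr 1
    ext X
    rw [← epiWithKernelIn_iff_of_isZero (P := P') (terminal.from X) terminalIsTerminal.isZero, ← h₄,
      mem_trivialFibrations_iff]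

/-- Hovey's correspondence, for the class of acyclic complexes: two compatible complete cotorsion
pairs of complexes induce an abelian model structure whose weak equivalences are the
quasi-isomorphisms. -/
theorem AreCompatible.exists_modelCategory {P P' Q' Q : ObjectProperty (CochainComplex A ℤ)}
    (h : AreCompatible P P' Q' Q) (h₁ : IsCompleteCotorsionPair P P')
    (h₂ : IsCompleteCotorsionPair Q' Q) :
    ∃ M : ModelCategory (CochainComplex A ℤ),
      letI := M
      IsAbelianModelStructure (CochainComplex A ℤ) ∧
      weakEquivalences (CochainComplex A ℤ) = HomologicalComplex.quasiIso A (.up ℤ) ∧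
      cofibrations (CochainComplex A ℤ) = monoWithCokernelIn P ∧
      trivialCofibrations (CochainComplex A ℤ) = monoWithCokernelIn Q' ∧
      fibrations (CochainComplex A ℤ) = epiWithKernelIn Q ∧
      trivialFibrations (CochainComplex A ℤ) = epiWithKernelIn P' := by
  let : CategoryWithCofibrations (CochainComplex A ℤ) := ⟨monoWithCokernelIn P⟩
  let : CategoryWithFibrations (CochainComplex A ℤ) := ⟨epiWithKernelIn Q⟩
  let : CategoryWithWeakEquivalences (CochainComplex A ℤ) :=
    ⟨HomologicalComplex.quasiIso A (.up ℤ)⟩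
  have hc : trivialCofibrations (CochainComplex A ℤ) = monoWithCokernelIn Q' := by
    rw [h.1, ← monoWithCokernelIn_inf_quasiIso]
    rfl
  have hf : trivialFibrations (CochainComplex A ℤ) = epiWithKernelIn P' := by
    rw [h.2, ← epiWithKernelIn_inf_quasiIso]
    rfl
  have : (weakEquivalences (CochainComplex A ℤ)).HasTwoOutOfThreeProperty :=
    inferInstanceAs (HomologicalComplex.quasiIso A (.up ℤ)).HasTwoOutOfThreeProperty
  have : MorphismProperty.IsWeakFactorizationSystem (cofibrations (CochainComplex A ℤ))
      (trivialFibrations (CochainComplex A ℤ)) := by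
    rw [hf]
    exact h₁.isWeakFactorizationSystem
  have : MorphismProperty.IsWeakFactorizationSystem (trivialCofibrations (CochainComplex A ℤ))
      (fibrations (CochainComplex A ℤ)) := by
    rw [hc]
    exact h₂.isWeakFactorizationSystem
  have := h₁.toIsCotorsionPair.left_isStableUnderRetracts
  have := h₁.toIsCotorsionPair.right_isStableUnderRetracts
  have := h₂.toIsCotorsionPair.left_isStableUnderRetracts
  have := h₂.toIsCotorsionPair.right_isStableUnderRetracts
  let M : ModelCategory (CochainComplex A ℤ) := ModelCategory.mk' _
  exact ⟨M, isAbelianModelStructure_of_eq (P := P) (P' := P') (Q' := Q') (Q := Q) rfl hc rfl hf,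
    rfl, rfl, hc, rfl, hf⟩

end

/-! ### The homotopy category -/

/-- If the weak equivalences of a model category are the quasi-isomorphisms, its homotopy category
is the derived category. -/
theorem exists_hoCat_equivalence_derivedCategory {A : Type u} [Category.{v} A] [Abelian A]
    [HasDerivedCategory.{w'} A] [ModelCategory (CochainComplex A ℤ)]
    (hW : weakEquivalences (CochainComplex A ℤ) = HomologicalComplex.quasiIso A (.up ℤ)) :
    (DerivedCategory.Q (C := A)).IsLocalization (weakEquivalences (CochainComplex A ℤ)) ∧
      ∃ e : BifibrantObject.HoCat (CochainComplex A ℤ) ≌ DerivedCategory A,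
        Nonempty (BifibrantObject.toHoCat ⋙ e.functor ≅
          BifibrantObject.ι ⋙ DerivedCategory.Q) := by
  have : (DerivedCategory.Q (C := A)).IsLocalization (weakEquivalences (CochainComplex A ℤ)) := by
    rw [hW]
    infer_instance
  exact ⟨this, Localization.uniq _ _ (weakEquivalences (BifibrantObject (CochainComplex A ℤ))),
    ⟨Localization.compUniqFunctor _ _ _⟩⟩

end CotorsionPairs

namespace CartesianModules

/-! ### Cartesian modules form a Grothendieck abelian category -/

variable {C : Type w} [SmallCategory C] (R : Cᵒᵖ ⥤ CommRingCat.{w})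

instance (J : Type w) [SmallCategory J] : (isCartesian R).IsClosedUnderColimitsOfShape J :=
  .mk <| by
    rintro M ⟨p⟩ X Y f
    have (X : Cᵒᵖ) : PreservesColimitsOfShape J (evalAt R X) :=
      inferInstanceAs (PreservesColimitsOfShape J
        (PresheafOfModules.evaluation.{w} (R ⋙ forget₂ CommRingCat RingCat) X))
    have : (ModuleCat.extendScalars.{w, w, w} (R.map f).hom).IsLeftAdjoint :=
      (ModuleCat.extendRestrictScalarsAdj (R.map f).hom).isLeftAdjoint
    exact isIso_app_of_isColimit (c := Cocone.mk M p.ι) (baseChange R f)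
      (fun j => p.prop_diag_obj j f) p.isColimit

instance [IsFlat R] (J : Type) [SmallCategory J] [FinCategory J] :
    (isCartesian R).IsClosedUnderLimitsOfShape J :=
  .mk <| by
    rintro M ⟨p⟩
    exact isCartesian_of_isLimit (c := Cone.mk M p.π) R p.prop_diag_obj p.isLimit

instance [IsFlat R] : PreservesFiniteLimits (isCartesian R).ι where
  preservesFiniteLimits _ _ _ := inferInstance

/-- The axiom AB5 for cartesian modules is inherited from presheaves of abelian groups: by flatness,
finite limits of cartesian modules are computed there, and all colimits are. -/
lemma isGrothendieckAbelian [IsFlat R] [HasSeparator (ModCart R)] :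
    IsGrothendieckAbelian.{w} (ModCart R) where
  hasFilteredColimitsOfSize := ⟨fun J _ _ => inferInstance⟩
  ab5OfSize := by
    have : HasFilteredColimitsOfSize.{w, w} (ModCart R) := ⟨fun J _ _ => inferInstance⟩
    refine ⟨fun J _ _ => ?_⟩
    let Φ : ModCart R ⥤ Cᵒᵖ ⥤ AddCommGrpCat.{w} :=
      (isCartesian R).ι ⋙ PresheafOfModules.toPresheaf (R ⋙ forget₂ CommRingCat RingCat)
    have : PreservesFiniteLimits Φ := comp_preservesFiniteLimits _ _
    have : ReflectsFiniteLimits Φ := reflectsFiniteLimits_of_reflectsIsomorphisms Φ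
    exact .domain_of_functor J Φ

end CartesianModules

theorem mainTheorem3 {C : Type w} [SmallCategory C] (R : Cᵒᵖ ⥤ CommRingCat.{w}) [IsFlat R]
    (F D : ObjectProperty (ModCart R)) (hFD : IsCotorsionPair F D)
    (hset : IsCogeneratedBySet D)
    (hgen : ∃ G : ModCart R, F G ∧ IsSeparator G)
    (hker : ∀ ⦃X Y : ModCart R⦄ (f : X ⟶ Y), Epi f → F X → F Y → F (kernel f)) :
    -- the two induced pairs are complete and compatible cotorsion pairs
    IsCompleteCotorsionPair (dgLeft F D) (tilde D) ∧
    IsCompleteCotorsionPair (tilde F) (dgRight F D) ∧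
    AreCompatible (dgLeft F D) (tilde D) (tilde F) (dgRight F D) ∧
    -- they induce an abelian model structure
    ∃ M : ModelCategory (CochainComplex (ModCart R) ℤ),
      letI := M
      IsAbelianModelStructure (CochainComplex (ModCart R) ℤ) ∧
      weakEquivalences (CochainComplex (ModCart R) ℤ) =
        HomologicalComplex.quasiIso (ModCart R) (ComplexShape.up ℤ) ∧
      cofibrations (CochainComplex (ModCart R) ℤ) = monoWithCokernelIn (dgLeft F D) ∧
      trivialCofibrations (CochainComplex (ModCart R) ℤ) = monoWithCokernelIn (tilde F) ∧
      fibrations (CochainComplex (ModCart R) ℤ) = epiWithKernelIn (dgRight F D) ∧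
      trivialFibrations (CochainComplex (ModCart R) ℤ) = epiWithKernelIn (tilde D) ∧
      -- the homotopy category is the derived category, both as the localization at the weak
      -- equivalences and as the category of bifibrant objects and homotopy classes of maps
      ∀ [HasDerivedCategory.{w'} (ModCart R)],
        (DerivedCategory.Q (C := ModCart R)).IsLocalization
          (weakEquivalences (CochainComplex (ModCart R) ℤ)) ∧
        ∃ e : BifibrantObject.HoCat (CochainComplex (ModCart R) ℤ) ≌ DerivedCategory (ModCart R),
          Nonempty (BifibrantObject.toHoCat ⋙ e.functor ≅
            BifibrantObject.ι ⋙ DerivedCategory.Q) := by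
  have : HasSeparator (ModCart R) := ⟨hgen.imp fun _ h => h.2⟩
  have := isGrothendieckAbelian R
  have h₁ := hFD.isCompleteCotorsionPair_dgLeft_tilde hgen hset
  have h₂ := hFD.isCompleteCotorsionPair_tilde_dgRight hgen hker hset
  have h₃ : AreCompatible (dgLeft F D) (tilde D) (tilde F) (dgRight F D) :=
    ⟨hFD.tilde_left_eq_inf hgen hker, hFD.tilde_right_eq_inf hgen hker hset⟩
  obtain ⟨M, hM, hW, h⟩ := h₃.exists_modelCategory h₁ h₂
  exact ⟨h₁, h₂, h₃, M, hM, hW, h.1, h.2.1, h.2.2.1, h.2.2.2,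
    exists_hoCat_equivalence_derivedCategory hW⟩
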